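/- Let $M$ be a smooth manifold (Hausdorff, finite-dimensional, without boundary), and let $(\phi,\xi,\eta,g)$ be a coKähler structure on $M$. That is, $\phi$ is a smooth $(1,1)$-tensor field, $\xi$ a smooth vector field, $\eta$ a smooth 1-form and $g$ a Riemannian metric such that $$\phi^2=-I+\eta\otimes\xi,\qquad \eta(\xi)=1,\qquad g(\phi X,\phi Y)=g(X,Y)-\eta(X)\eta(Y),$$ both $\eta$ and the fundamental 2-form $\Omega(X,Y)=g(X,\phi Y)$ are closed, and the structure is normal, i.e. $N_\phi=-2\,\xi\otimes d\eta$ (which is then $0$), where $N_\phi(X,Y)=[\phi X,\phi Y]+\phi^2[X,Y]-\phi[X,\phi Y]-\phi[\phi X,Y]$. On $TM\oplus T^*M$ define $$\Phi=\begin{pmatrix}\phi&0\\0&-\phi^*\end{pmatrix},\qquad E_+=\xi,\qquad E_-=\eta,\qquad G=\begin{pmatrix}0&g^{-1}\\ g&0\end{pmatrix},$$ where $(\phi^*\alpha)(X)=\alpha(\phi X)$. Then $\Phi,E_\pm,G$ are smooth and $(\Phi,E_+,E_-,G)$ is a generalized coKähler structure on $M$. This notion is defined as follows. Let $\langle X+\alpha,Y+\beta\rangle=\tfrac12(\beta(X)+\alpha(Y))$,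 let $$[[X+\alpha,Y+\beta]]=[X,Y]+\mathcal L_X\beta-\mathcal L_Y\alpha-\tfrac12 d(\iota_X\beta-\iota_Y\alpha)$$ be the (untwisted) Courant bracket, extended complex bilinearly to $(TM\oplus T^*M)\otimes\mathbb C$, and write $(A\otimes B)(Z)=2\langle B,Z\rangle A$. * A triple $(\Phi,E_+,E_-)$, with $\Phi$ an endomorphism and $E_\pm$ sections of $TM\oplus T^*M$, is a generalized almost contact structure if $\langle\Phi A,B\rangle+\langle A,\Phi B\rangle=0$ for all $A,B$, $\Phi^2=-\mathrm{Id}+E_+\otimes E_-+E_-\otimes E_+$, $\langle E_\pm,E_\pm\rangle=0$ and $2\langle E_+,E_-\rangle=1$. * It is strong if the smooth sections of each of $L^\pm=L_{E_\pm}\oplus E^{(1,0)}$ are closed under the Courant bracket, where $L_{E_\pm}$ is the complex line bundle spanned by $E_\pm$ and $E^{(1,0)}$ is the $\sqrt{-1}$-eigenbundle of $\Phi$. * $(\Phi,E_+,E_-,G)$ is generalized coKähler if: $(\Phi,E_+,E_-)$ is a strong generalized almost contact structure with $[[E_+,E_-]]=0$; $G$ is a generalized Riemannian metric, i.e. an endomorphism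 of $TM\oplus T^*M$ that is self-adjoint for $\langle\cdot,\cdot\rangle$ with $G^2=1$ and $\langle GA,A\rangle>0$ for $A\ne0$; $-\Phi G\Phi=G-E_+\otimes E_+-E_-\otimes E_-$; and $(G\Phi,GE_+,GE_-)$ is also a strong generalized almost contact structure. -/

import Mathlib

open scoped Manifold ContDiff TensorProduct

noncomputable section

namespace GenCoKahler

section Fields

variable (E : Type*) [NormedAddCommGroup E] [NormedSpace ℝ E]
  (M : Type*) [TopologicalSpace M] [ChartedSpace E M] [IsManifold 𝓘(ℝ, E) ∞ M]

/-- The tangent space `T_x M`. -/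
abbrev Tan (x : M) : Type _ := TangentSpace 𝓘(ℝ, E) x

/-- The cotangent space `T_x^* M`. -/
abbrev Cotan (x : M) : Type _ := Tan E M x →L[ℝ] Bundle.Trivial M ℝ x

/-- The fibre `T_x M ⊕ T_x^* M` of the big tangent bundle. -/
abbrev Big (x : M) : Type _ := Tan E M x × Cotan E M x

/-- Smooth vector fields. -/
abbrev VField := ContMDiffSection 𝓘(ℝ, E) E ∞ (Tan E M)

/-- Smooth 1-forms. -/
abbrev OneForm := ContMDiffSection 𝓘(ℝ, E) (E →L[ℝ] ℝ) ∞ (Cotan E M)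

/-- Smooth (1,1) tensor fields. -/
abbrev EndField :=
  ContMDiffSection 𝓘(ℝ, E) (E →L[ℝ] E) ∞ (fun x : M => Tan E M x →L[ℝ] Tan E M x)

/-- Smooth Riemannian metrics. -/
abbrev Metric := Bundle.ContMDiffRiemannianMetric 𝓘(ℝ, E) ∞ E (Tan E M)

/-- Smooth sections of the big tangent bundle. -/
abbrev BigSection := ContMDiffSection 𝓘(ℝ, E) (E × (E →L[ℝ] ℝ)) ∞ (Big E M)

/-- Smooth bundle endomorphisms of the big tangent bundle. -/
abbrev BigEnd :=
  ContMDiffSection 𝓘(ℝ, E) ((E × (E →L[ℝ] ℝ)) →L[ℝ] (E × (E →L[ℝ] ℝ))) ∞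
    (fun x : M => Big E M x →L[ℝ] Big E M x)

end Fields

variable {E : Type*} [NormedAddCommGroup E] [NormedSpace ℝ E]
  {M : Type*} [TopologicalSpace M] [ChartedSpace E M] [IsManifold 𝓘(ℝ, E) ∞ M]

/-! ### Classical structures -/

/-- The derivative `X f` at `x` of a function `f` along a vector field `X`. -/
def along (X : Π x : M, Tan E M x) (f : M → ℝ) (x : M) : ℝ := mvfderiv 𝓘(ℝ, E) f x (X x)

/-- The Lie bracket `[X, Y]` of vector fields. -/
abbrev bracket (X Y : Π x : M, Tan E M x) : Π x : M, Tan E M x :=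
  VectorField.mlieBracket 𝓘(ℝ, E) X Y

/-- `dη(X, Y) = X (η Y) - Y (η X) - η [X, Y]`. -/
def extDerivOne (η : OneForm E M) (X Y : VField E M) (x : M) : ℝ :=
  along X (fun y => η y (Y y)) x - along Y (fun y => η y (X y)) x - η x (bracket X Y x)

/-- `dθ(X, Y, Z)` for a 2-form `θ`, by the invariant formula. -/
def extDerivTwo (θ : Π x : M, Tan E M x → Tan E M x → ℝ) (X Y Z : VField E M) (x : M) : ℝ :=
  along X (fun y => θ y (Y y) (Z y)) x - along Y (fun y => θ y (X y) (Z y)) x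
    + along Z (fun y => θ y (X y) (Y y)) x
    - θ x (bracket X Y x) (Z x) + θ x (bracket X Z x) (Y x) - θ x (bracket Y Z x) (X x)

/-- The fundamental 2-form `Ω(v, w) = g(v, φ w)`. -/
def fundamentalForm (φ : EndField E M) (g : Metric E M) (x : M) (v w : Tan E M x) : ℝ :=
  g.inner x v (φ x w)

/-- The Nijenhuis torsion `N_φ(X, Y) = [φX, φY] + φ²[X, Y] - φ[X, φY] - φ[φX, Y]`. -/
def nijenhuis (φ : EndField E M) (X Y : VField E M) (x : M) : Tan E M x :=
  bracket (fun y => φ y (X y)) (fun y => φ y (Y y)) x + φ x (φ x (bracket X Y x))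
    - φ x (bracket X (fun y => φ y (Y y)) x) - φ x (bracket (fun y => φ y (X y)) Y x)

/-- Almost contact metric structures: `φ² = -I + η ⊗ ξ`, `η(ξ) = 1`,
`g(φX, φY) = g(X, Y) - η(X) η(Y)`. -/
structure IsAlmostContactMetric (φ : EndField E M) (ξ : VField E M) (η : OneForm E M)
    (g : Metric E M) : Prop where
  sq : ∀ (x : M) (v : Tan E M x), φ x (φ x v) = -v + (η x v : ℝ) • ξ x
  eta_xi : ∀ x : M, η x (ξ x) = (1 : ℝ)
  compat : ∀ (x : M) (v w : Tan E M x),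
    g.inner x (φ x v) (φ x w) = g.inner x v w - (η x v : ℝ) * (η x w : ℝ)

/-- CoKähler structures: almost contact metric structures with `η` and `Ω` closed which are
normal, `N_φ = -2 ξ ⊗ dη`. -/
structure IsCoKahler (φ : EndField E M) (ξ : VField E M) (η : OneForm E M)
    (g : Metric E M) : Prop where
  almostContactMetric : IsAlmostContactMetric φ ξ η g
  closed_eta : ∀ (X Y : VField E M) (x : M), extDerivOne η X Y x = 0
  closed_fundamental : ∀ (X Y Z : VField E M) (x : M),
    extDerivTwo (fundamentalForm φ g) X Y Z x = 0
  normal : ∀ (X Y : VField E M) (x : M),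
    nijenhuis φ X Y x = (-(2 * extDerivOne η X Y x)) • ξ x

/-! ### The Courant bracket -/

/-- The vector field underlying a section of the big tangent bundle. -/
def vecPart (A : BigSection E M) (x : M) : Tan E M x := (A x).1

/-- The 1-form underlying a section of the big tangent bundle. -/
def formPart (A : BigSection E M) (x : M) : Cotan E M x := (A x).2

/-- `(L_X β)(Z) = X (β Z) - β [X, Z]` at the point `x`. -/
def lieFormAux (X : Π x : M, Tan E M x) (β : Π x : M, Cotan E M x) (x : M)
    (Z : Π x : M, Tan E M x) : ℝ :=
  along X (fun y => β y (Z y)) x - β x (bracket X Z x)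

theorem formPart_smooth (A : BigSection E M) :
    ContMDiff 𝓘(ℝ, E) (𝓘(ℝ, E).prod 𝓘(ℝ, E →L[ℝ] ℝ)) ∞
      (fun x => Bundle.TotalSpace.mk' (E →L[ℝ] ℝ) (E := Cotan E M) x (formPart A x)) := by
  intro x
  have h := A.contMDiff x
  rw [Bundle.contMDiffAt_section] at h
  have h2 := ((contDiff_snd (𝕜 := ℝ) (E := E) (F := E →L[ℝ] ℝ)
    (n := ∞)).contMDiff.contMDiffAt).comp x h
  exact (Bundle.contMDiffAt_section _).2 h2

theorem tensorialAt_lieFormAux [FiniteDimensional ℝ E] (X : Π x : M, Tan E M x)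
    (β : Π x : M, Cotan E M x) (x : M)
    (hβ : ContMDiff 𝓘(ℝ, E) (𝓘(ℝ, E).prod 𝓘(ℝ, E →L[ℝ] ℝ)) ∞
      (fun x => Bundle.TotalSpace.mk' (E →L[ℝ] ℝ) (E := Cotan E M) x (β x))) :
    TensorialAt 𝓘(ℝ, E) E (lieFormAux X β x) x := by
  have : CompleteSpace E := FiniteDimensional.complete ℝ E
  have hp : ∀ {Z : Π y : M, Tan E M y},
      MDifferentiableAt 𝓘(ℝ, E) (𝓘(ℝ, E).prod 𝓘(ℝ, E))
        (fun y => Bundle.TotalSpace.mk' E (E := Tan E M) y (Z y)) x →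
      MDifferentiableAt 𝓘(ℝ, E) 𝓘(ℝ, ℝ) (fun y => (β y (Z y) : ℝ)) x := by
    intro Z hZ
    have hb := (hβ x).mdifferentiableAt (by simp)
    have := MDifferentiableAt.clm_bundle_apply (F₁ := E) (F₂ := ℝ) hb hZ
    rw [mdifferentiableAt_totalSpace] at this
    exact this.2
  constructor
  · intro f Z hf hZ
    have e : (fun y => (β y ((f • Z) y) : ℝ)) = f * fun y => (β y (Z y) : ℝ) := by
      funext y
      simp
    simp only [lieFormAux, along, bracket]
    rw [e, mvfderiv_mul hf (hp hZ), VectorField.mlieBracket_smul_right hf hZ]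
    simp
    ring
  · intro Z W hZ hW
    have e : (fun y => (β y ((Z + W) y) : ℝ))
        = (fun y => (β y (Z y) : ℝ)) + fun y => (β y (W y) : ℝ) := by
      funext y
      simp
    simp only [lieFormAux, along, bracket]
    rw [e, mvfderiv_add (hp hZ) (hp hW), VectorField.mlieBracket_add_right hZ hW]
    simp
    ring

/-- The Lie derivative `L_X β`, where `X` is the vector part of `A` and `β` is the 1-form part of
`B`: the covector at `x` whose value on `Z x` is `X (β Z) - β [X, Z]` at `x`. -/
def lieForm [FiniteDimensional ℝ E] (A B : BigSection E M) (x : M) : Cotan E M x :=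
  TensorialAt.mkHom (lieFormAux (vecPart A) (formPart B) x) x
    (tensorialAt_lieFormAux _ _ x (formPart_smooth B))

/-- The (untwisted) Courant bracket
`[[X + α, Y + β]] = [X, Y] + L_X β - L_Y α - ½ d(ι_X β - ι_Y α)`. -/
def courant [FiniteDimensional ℝ E] (A B : BigSection E M) (x : M) : Big E M x :=
  (bracket (vecPart A) (vecPart B) x,
    lieForm A B x - lieForm B A x
      - (1 / 2 : ℝ) • (mvfderiv 𝓘(ℝ, E)
          (fun y => (formPart B y (vecPart A y) : ℝ) - formPart A y (vecPart B y)) x :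
          Cotan E M x))

/-! ### Generalized structures -/

/-- The neutral metric `⟨X + α, Y + β⟩ = ½ (β(X) + α(Y))`. -/
def pairing {x : M} (a b : Big E M x) : ℝ := (1 / 2 : ℝ) * ((b.2 a.1 : ℝ) + a.2 b.1)

/-- `(A ⊗ B)(z) = 2⟨B, z⟩ A`, where `B` is viewed as a linear form on `TM ⊕ T^*M` through the
natural pairing of tangent and cotangent vectors. -/
def tensor {x : M} (a b z : Big E M x) : Big E M x := (2 * pairing b z) • a

/-- Generalized almost contact structures (pointwise conditions). -/
structure IsGenAlmostContact (Φ : Π x : M, Big E M x →L[ℝ] Big E M x)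
    (Ep Em : Π x : M, Big E M x) : Prop where
  skew : ∀ (x : M) (a b : Big E M x), pairing (Φ x a) b + pairing a (Φ x b) = 0
  sq : ∀ (x : M) (a : Big E M x),
    Φ x (Φ x a) = -a + tensor (Ep x) (Em x) a + tensor (Em x) (Ep x) a
  null_plus : ∀ x : M, pairing (Ep x) (Ep x) = 0
  null_minus : ∀ x : M, pairing (Em x) (Em x) = 0
  dual : ∀ x : M, 2 * pairing (Ep x) (Em x) = 1

/-- The fibre `(T_x M ⊕ T_x^* M) ⊗ ℂ`. -/
abbrev BigC (E : Type*) [NormedAddCommGroup E] [NormedSpace ℝ E]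
    (M : Type*) [TopologicalSpace M] [ChartedSpace E M] [IsManifold 𝓘(ℝ, E) ∞ M] (x : M) :
    Type _ := ℂ ⊗[ℝ] Big E M x

/-- The fibre at `x` of `E^{(1,0)}`, the `√-1`-eigenbundle of `Φ`. -/
def eigenI (Φ : Π x : M, Big E M x →L[ℝ] Big E M x) (x : M) : Submodule ℂ (BigC E M x) :=
  Module.End.eigenspace
    (LinearMap.baseChange ℂ (Φ x : Big E M x →ₗ[ℝ] Big E M x) : Module.End ℂ (BigC E M x))
    Complex.I

/-- The fibre at `x` of `L_e ⊕ E^{(1,0)}`, with `L_e` the complex line spanned by `e`. -/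
def lineSum (Φ : Π x : M, Big E M x →L[ℝ] Big E M x) (e : Π x : M, Big E M x) (x : M) :
    Submodule ℂ (BigC E M x) :=
  Submodule.span ℂ {(1 : ℂ) ⊗ₜ[ℝ] e x} ⊔ eigenI Φ x

/-- The value `a + √-1 b` in the complexified fibre. -/
def cplx {x : M} (a b : Big E M x) : BigC E M x := (1 : ℂ) ⊗ₜ[ℝ] a + Complex.I ⊗ₜ[ℝ] b

/-- Closure of the smooth sections of a complex subbundle `L` of `(TM ⊕ T^*M) ⊗ ℂ` under the
complex bilinear extension of the Courant bracket. Smooth sections are written `A + √-1 B` with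
real smooth sections `A`, `B`. -/
def IsInvolutive [FiniteDimensional ℝ E] (L : Π x : M, Submodule ℂ (BigC E M x)) : Prop :=
  ∀ A B C D : BigSection E M,
    (∀ x, cplx (A x) (B x) ∈ L x) → (∀ x, cplx (C x) (D x) ∈ L x) →
      ∀ x, cplx (courant A C x - courant B D x) (courant A D x + courant B C x) ∈ L x

/-- Strong generalized contact structures: both `L^+ = L_{E_+} ⊕ E^{(1,0)}` and
`L^- = L_{E_-} ⊕ E^{(1,0)}` are closed under the Courant bracket. -/
structure IsStrong [FiniteDimensional ℝ E] (Φ : Π x : M, Big E M x →L[ℝ] Big E M x)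
    (Ep Em : Π x : M, Big E M x) : Prop where
  almostContact : IsGenAlmostContact Φ Ep Em
  plus : IsInvolutive (lineSum Φ Ep)
  minus : IsInvolutive (lineSum Φ Em)

/-- Generalized Riemannian metrics: `G^* = G`, `G² = 1`, and `⟨G a, a⟩` positive definite. -/
structure IsGenMetric (G : Π x : M, Big E M x →L[ℝ] Big E M x) : Prop where
  selfAdjoint : ∀ (x : M) (a b : Big E M x), pairing (G x a) b = pairing a (G x b)
  sq : ∀ (x : M) (a : Big E M x), G x (G x a) = a
  pos : ∀ (x : M) (a : Big E M x), a ≠ 0 → 0 < pairing (G x a) a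

/-- Generalized coKähler structures: normal generalized contact metric structures
`(Φ, E_+, E_-, G)` such that `GΦ`, with the sections `G E_+` and `G E_-`, is strong as well. -/
structure IsGenCoKahler [FiniteDimensional ℝ E] (Φ : BigEnd E M) (Ep Em : BigSection E M)
    (G : BigEnd E M) : Prop where
  strong : IsStrong Φ Ep Em
  bracket_zero : ∀ x : M, courant Ep Em x = 0
  genMetric : IsGenMetric G
  compat : ∀ (x : M) (a : Big E M x),
    -(Φ x (G x (Φ x a))) = G x a - tensor (Ep x) (Ep x) a - tensor (Em x) (Em x) a
  strong_comp : IsStrong (fun x => (G x).comp (Φ x)) (fun x => G x (Ep x)) (fun x => G x (Em x))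

end GenCoKahler

end

/-! The algebraic conditions are pointwise linear algebra. Since `φ` is skew for `g`, `G` commutes
with `Φ`; moreover `G` exchanges `E_+` and `E_-` and is an isometry of the pairing. So everything
about `GΦ` follows from `Φ`, and `-ΦGΦ = -Φ²G` gives the metric compatibility.

Integrability comes from one Dirac-type criterion, `isInvolutive_of_closed`. Given an involutive `D
⊂ TM ⊗ ℂ` and a closed 2-form `θ`, consider the `Z + ζ` with `Z ∈ D` and `ζ = √-1 θ(Z, ·)` on `D`.
On `W ∈ D` the covector part of the bracket of `Z + ζ` and `Z' + ζ'` is `√-1 (dθ(Z, Z', W) + θ([Z,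
Z'], W))`, so such sections are closed under the bracket.

All four bundles have this form (the `mem_lineSum_*` lemmas). For `Φ`, `θ = 0` and `D` is `⟨ξ⟩ ⊕
T^{1,0}` or `T^{1,0}`, where `T^{1,0}` is the `√-1`-eigenbundle of `φ`. For `GΦ`, `θ = Ω` and `D` is
`ker η` or all of `TM ⊗ ℂ`. Involutivity of `ker η` is `dη = 0`; that of `T^{1,0}` follows from `N_φ
= 0` and `dη = 0`; adding `ξ` also needs `L_ξ φ = 0` (`phi_bracket_xi`). -/

noncomputable section

namespace GenCoKahler

open Bundle ContinuousLinearMap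

/-! ### Smoothness of bundle homomorphisms and of their inverses -/

section HomBundle

variable {E : Type*} [NormedAddCommGroup E] [NormedSpace ℝ E]
  {M : Type*} [TopologicalSpace M] [ChartedSpace E M]
  {F₁ : Type*} [NormedAddCommGroup F₁] [NormedSpace ℝ F₁] {V : M → Type*}
  [TopologicalSpace (TotalSpace F₁ V)] [∀ x, TopologicalSpace (V x)] [∀ x, AddCommGroup (V x)]
  [∀ x, Module ℝ (V x)] [FiberBundle F₁ V] [VectorBundle ℝ F₁ V]
  {F₂ : Type*} [NormedAddCommGroup F₂] [NormedSpace ℝ F₂] {W : M → Type*}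
  [TopologicalSpace (TotalSpace F₂ W)] [∀ x, TopologicalSpace (W x)] [∀ x, AddCommGroup (W x)]
  [∀ x, Module ℝ (W x)] [FiberBundle F₂ W] [VectorBundle ℝ F₂ W]

/-- A map into a space of linear maps out of a finite-dimensional space is smooth as soon as its
evaluations are. -/
theorem contMDiffAt_clm_of_apply [FiniteDimensional ℝ F₁] {f : M → F₁ →L[ℝ] F₂} {x₀ : M}
    (h : ∀ v, ContMDiffAt 𝓘(ℝ, E) 𝓘(ℝ, F₂) ∞ (fun x => f x v) x₀) :
    ContMDiffAt 𝓘(ℝ, E) 𝓘(ℝ, F₁ →L[ℝ] F₂) ∞ f x₀ := by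
  let b := Module.finBasis ℝ F₁
  have e : f = fun x => ∑ i, smulRightL ℝ F₁ F₂ (LinearMap.toContinuousLinearMap (b.coord i))
      (f x (b i)) := by
    funext x
    ext v
    conv_lhs => rw [← b.sum_repr v, map_sum]
    simp
  rw [e]
  refine ContMDiffAt.sum fun i _ => ?_
  exact (contMDiffAt_const (c := smulRightL ℝ F₁ F₂
    (LinearMap.toContinuousLinearMap (b.coord i)))).clm_apply (h (b i))

variable [∀ x, IsTopologicalAddGroup (W x)] [∀ x, ContinuousSMul ℝ (W x)]

/-- A section of a homomorphism bundle is smooth at a point as soon as it maps sections which are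
smooth at that point to such sections. -/
theorem contMDiffAt_hom_of_apply [FiniteDimensional ℝ F₁]
    [∀ x, IsTopologicalAddGroup (V x)] [∀ x, ContinuousSMul ℝ (V x)]
    [ContMDiffVectorBundle ∞ F₁ V 𝓘(ℝ, E)] {Φ : Π x : M, V x →L[ℝ] W x} {x₀ : M}
    (h : ∀ s : Π x : M, V x,
      ContMDiffAt 𝓘(ℝ, E) (𝓘(ℝ, E).prod 𝓘(ℝ, F₁)) ∞ (fun x => TotalSpace.mk' F₁ x (s x)) x₀ →
      ContMDiffAt 𝓘(ℝ, E) (𝓘(ℝ, E).prod 𝓘(ℝ, F₂)) ∞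
        (fun x => TotalSpace.mk' F₂ x (Φ x (s x))) x₀) :
    ContMDiffAt 𝓘(ℝ, E) (𝓘(ℝ, E).prod 𝓘(ℝ, F₁ →L[ℝ] F₂)) ∞
      (fun x => TotalSpace.mk' (F₁ →L[ℝ] F₂) (E := fun x => V x →L[ℝ] W x) x (Φ x)) x₀ := by
  rw [contMDiffAt_hom_bundle]
  refine ⟨contMDiffAt_id, contMDiffAt_clm_of_apply fun v => ?_⟩
  let e := trivializationAt F₁ V x₀
  have hx : x₀ ∈ e.baseSet := FiberBundle.mem_baseSet_trivializationAt' x₀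
  -- Test on the local section with constant value `v` in the trivialization; its image is `Φ` in
  -- coordinates applied to `v`.
  have hs := h (fun x => e.symmL ℝ x v)
    ((e.contMDiffAt_symmL (IB := 𝓘(ℝ, E)) (n := ∞) hx).clm_bundle_apply
      (E₁ := Bundle.Trivial M F₁) (v := fun _ => v)
      ((contMDiffAt_section x₀).2 contMDiffAt_const))
  rw [contMDiffAt_section] at hs
  refine hs.congr_of_eventuallyEq ?_
  filter_upwards [(trivializationAt F₂ W x₀).open_baseSet.mem_nhds
    (FiberBundle.mem_baseSet_trivializationAt' x₀)] with x hx₂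
  simp [ContinuousLinearMap.inCoordinates, e,
    Trivialization.coe_linearMapAt_of_mem _ hx₂]

/-- A bundle map which inverts a smooth isomorphism of vector bundles maps smooth sections to
smooth sections. -/
theorem contMDiffAt_of_hom_apply [CompleteSpace F₁]
    {Φ : Π x : M, V x →L[ℝ] W x} {x₀ : M} {s : Π x : M, V x}
    (hΦ : ContMDiffAt 𝓘(ℝ, E) (𝓘(ℝ, E).prod 𝓘(ℝ, F₁ →L[ℝ] F₂)) ∞
      (fun x => TotalSpace.mk' (F₁ →L[ℝ] F₂) (E := fun x => V x →L[ℝ] W x) x (Φ x)) x₀)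
    (hinv : ∀ x, (Φ x).IsInvertible)
    (hs : ContMDiffAt 𝓘(ℝ, E) (𝓘(ℝ, E).prod 𝓘(ℝ, F₂)) ∞
        (fun x => TotalSpace.mk' F₂ x (Φ x (s x))) x₀) :
    ContMDiffAt 𝓘(ℝ, E) (𝓘(ℝ, E).prod 𝓘(ℝ, F₁)) ∞ (fun x => TotalSpace.mk' F₁ x (s x)) x₀ := by
  rw [contMDiffAt_section] at hs ⊢
  rw [contMDiffAt_hom_bundle] at hΦ
  have hΦ2 := hΦ.2
  simp only at hΦ2
  set e₁ := trivializationAt F₁ V x₀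
  set e₂ := trivializationAt F₂ W x₀
  have hx₁ : x₀ ∈ e₁.baseSet := FiberBundle.mem_baseSet_trivializationAt' x₀
  have hx₂ : x₀ ∈ e₂.baseSet := FiberBundle.mem_baseSet_trivializationAt' x₀
  have hI : ∀ x, x ∈ e₁.baseSet → x ∈ e₂.baseSet →
      (inCoordinates F₁ V F₂ W x₀ x x₀ x (Φ x)).IsInvertible ∧
      inCoordinates F₁ V F₂ W x₀ x x₀ x (Φ x) (e₁ ⟨x, s x⟩).2 = (e₂ ⟨x, Φ x (s x)⟩).2 := by
    intro x h₁ h₂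
    rw [inCoordinates_eq h₁ h₂]
    constructor
    · obtain ⟨f, hf⟩ := hinv x
      exact ⟨((e₁.continuousLinearEquivAt ℝ x h₁).symm.trans f).trans
        (e₂.continuousLinearEquivAt ℝ x h₂), by rw [← hf]; rfl⟩
    · have : (e₁ ⟨x, s x⟩).2 = e₁.continuousLinearEquivAt ℝ x h₁ (s x) := by simp
      rw [this]
      change e₂.continuousLinearEquivAt ℝ x h₂ (Φ x ((e₁.continuousLinearEquivAt ℝ x h₁).symm
        (e₁.continuousLinearEquivAt ℝ x h₁ (s x)))) = _
      rw [ContinuousLinearEquiv.symm_apply_apply]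
      simp
  -- Inversion is a smooth map near an invertible operator, so the coordinate expression of the
  -- inverse is smooth.
  have hinvC : ContMDiffAt 𝓘(ℝ, E) 𝓘(ℝ, F₂ →L[ℝ] F₁) ∞
      (fun x => (inCoordinates F₁ V F₂ W x₀ x x₀ x (Φ x)).inverse) x₀ :=
    ((hI x₀ hx₁ hx₂).1.contDiffAt_map_inverse (n := ∞)).contMDiffAt.comp x₀ hΦ2
  refine (hinvC.clm_apply hs).congr_of_eventuallyEq ?_
  filter_upwards [e₁.open_baseSet.mem_nhds hx₁, e₂.open_baseSet.mem_nhds hx₂] with x h₁ h₂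
  obtain ⟨h, h'⟩ := hI x h₁ h₂
  rw [← h', eq_comm, h.inverse_apply_eq]

end HomBundle

/-! ### Components of sections of `TM ⊕ T^*M` -/

section Basic

variable {E : Type*} [NormedAddCommGroup E] [NormedSpace ℝ E]
  {M : Type*} [TopologicalSpace M] [ChartedSpace E M] [IsManifold 𝓘(ℝ, E) ∞ M]

theorem contMDiffAt_big_mk {X : Π x : M, Tan E M x} {α : Π x : M, Cotan E M x} {x : M}
    (hX : ContMDiffAt 𝓘(ℝ, E) (𝓘(ℝ, E).prod 𝓘(ℝ, E)) ∞
      (fun x => TotalSpace.mk' E (E := Tan E M) x (X x)) x)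
    (hα : ContMDiffAt 𝓘(ℝ, E) (𝓘(ℝ, E).prod 𝓘(ℝ, E →L[ℝ] ℝ)) ∞
      (fun x => TotalSpace.mk' (E →L[ℝ] ℝ) (E := Cotan E M) x (α x)) x) :
    ContMDiffAt 𝓘(ℝ, E) (𝓘(ℝ, E).prod 𝓘(ℝ, E × (E →L[ℝ] ℝ))) ∞
      (fun x => TotalSpace.mk' (E × (E →L[ℝ] ℝ)) (E := Big E M) x (X x, α x)) x := by
  rw [contMDiffAt_section] at hX hα ⊢
  exact hX.prodMk_space hα

theorem contMDiffAt_big_fst {A : Π x : M, Big E M x} {x : M}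
    (hA : ContMDiffAt 𝓘(ℝ, E) (𝓘(ℝ, E).prod 𝓘(ℝ, E × (E →L[ℝ] ℝ))) ∞
      (fun x => TotalSpace.mk' (E × (E →L[ℝ] ℝ)) (E := Big E M) x (A x)) x) :
    ContMDiffAt 𝓘(ℝ, E) (𝓘(ℝ, E).prod 𝓘(ℝ, E)) ∞
      (fun x => TotalSpace.mk' E (E := Tan E M) x (A x).1) x := by
  rw [contMDiffAt_section] at hA ⊢
  exact ((contDiff_fst (𝕜 := ℝ) (E := E) (F := E →L[ℝ] ℝ)
    (n := ∞)).contMDiff.contMDiffAt).comp x hA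

theorem contMDiffAt_big_snd {A : Π x : M, Big E M x} {x : M}
    (hA : ContMDiffAt 𝓘(ℝ, E) (𝓘(ℝ, E).prod 𝓘(ℝ, E × (E →L[ℝ] ℝ))) ∞
      (fun x => TotalSpace.mk' (E × (E →L[ℝ] ℝ)) (E := Big E M) x (A x)) x) :
    ContMDiffAt 𝓘(ℝ, E) (𝓘(ℝ, E).prod 𝓘(ℝ, E →L[ℝ] ℝ)) ∞
      (fun x => TotalSpace.mk' (E →L[ℝ] ℝ) (E := Cotan E M) x (A x).2) x := by
  rw [contMDiffAt_section] at hA ⊢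
  exact ((contDiff_snd (𝕜 := ℝ) (E := E) (F := E →L[ℝ] ℝ)
    (n := ∞)).contMDiff.contMDiffAt).comp x hA

end Basic

/-! ### Calculus of global vector fields, 1-forms and the Courant bracket -/

section VectorFields

set_option linter.unusedSectionVars false

variable {E : Type*} [NormedAddCommGroup E] [NormedSpace ℝ E]
  {M : Type*} [TopologicalSpace M] [ChartedSpace E M] [IsManifold 𝓘(ℝ, E) ∞ M]

variable (E) in
/-- Smooth real functions. -/
abbrev SmoothFun (f : M → ℝ) : Prop := ContMDiff 𝓘(ℝ, E) 𝓘(ℝ, ℝ) ∞ f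

theorem SmoothFun.mdiff {f : M → ℝ} (hf : SmoothFun E f) (x : M) :
    MDifferentiableAt 𝓘(ℝ, E) 𝓘(ℝ, ℝ) f x := (hf x).mdifferentiableAt (by simp)

theorem VField.mdiff (X : VField E M) (x : M) :
    MDifferentiableAt 𝓘(ℝ, E) (𝓘(ℝ, E).prod 𝓘(ℝ, E))
      (fun y => TotalSpace.mk' E (E := Tan E M) y (X y)) x := X.mdifferentiableAt

theorem smoothFun_apply (η : OneForm E M) (X : VField E M) :
    SmoothFun E (fun y => (η y (X y) : ℝ)) := by
  intro x
  have := (η.contMDiff x).clm_bundle_apply (X.contMDiff x)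
  rw [contMDiffAt_section] at this
  exact this

/-- The vector field `φ X`. -/
def EndField.app (φ : EndField E M) (X : VField E M) : VField E M :=
  ⟨fun x => φ x (X x), fun x => (φ.contMDiff x).clm_bundle_apply (X.contMDiff x)⟩

/-- The vector field `f X`. -/
def fsmul (f : M → ℝ) (hf : SmoothFun E f) (X : VField E M) : VField E M :=
  ⟨fun x => f x • X x, hf.smul_section X.contMDiff⟩

/-- The vector part of a smooth section, as a smooth vector field. -/
def vecField (A : BigSection E M) : VField E M :=
  ⟨vecPart A, fun x => contMDiffAt_big_fst (A.contMDiff x)⟩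

/-- The form part of a smooth section, as a smooth 1-form. -/
def formField (A : BigSection E M) : OneForm E M := ⟨formPart A, formPart_smooth A⟩

theorem smoothFun_metric (g : Metric E M) (X Y : VField E M) :
    SmoothFun E (fun y => (g.inner y (X y) (Y y) : ℝ)) := by
  intro x
  have := ((g.contMDiff x).clm_bundle_apply (E₁ := Tan E M)
    (E₂ := Cotan E M) (X.contMDiff x)).clm_bundle_apply (Y.contMDiff x)
  rw [contMDiffAt_section] at this
  exact this

/-- Extend `v` locally and multiply by a bump function supported where the extension is smooth; the
Hausdorff property makes the bump function smooth on all of `M`. -/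
theorem exists_vfield_eq [FiniteDimensional ℝ E] [T2Space M] (x : M) (v : Tan E M x) :
    ∃ X : VField E M, X x = v := by
  obtain ⟨s, hs, hsv⟩ := FiberBundle.exists_contMDiffOn_extend (k := ∞) 𝓘(ℝ, E) E v
  obtain ⟨ψ, -, hψ⟩ := (SmoothBumpFunction.nhds_basis_tsupport (I := 𝓘(ℝ, E)) x).mem_iff.1
    (interior_mem_nhds.2 hs)
  refine ⟨⟨fun y => ψ y • FiberBundle.extend E v y, ?_⟩, ?_⟩
  · exact ContMDiffOn.smul_section_of_tsupport (ψ.contMDiff.contMDiffOn) isOpen_interior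
      hψ (hsv.mono interior_subset)
  · change ψ x • FiberBundle.extend E v x = v
    simp

theorem along_add (X : Π x : M, Tan E M x) {f g : M → ℝ} (hf : SmoothFun E f)
    (hg : SmoothFun E g) (x : M) :
    along X (fun y => f y + g y) x = along X f x + along X g x := by
  have := mvfderiv_add (hf.mdiff x) (hg.mdiff x)
  change (mvfderiv 𝓘(ℝ, E) (f + g) x) (X x) = _
  rw [this]
  rfl

theorem along_sub (X : Π x : M, Tan E M x) {f g : M → ℝ} (hf : SmoothFun E f)
    (hg : SmoothFun E g) (x : M) :
    along X (fun y => f y - g y) x = along X f x - along X g x := by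
  have := mvfderiv_sub (hf.mdiff x) (hg.mdiff x)
  change (mvfderiv 𝓘(ℝ, E) (f - g) x) (X x) = _
  rw [this]
  rfl

theorem along_neg (X : Π x : M, Tan E M x) {f : M → ℝ} (x : M) :
    along X (fun y => -f y) x = -along X f x := by
  change (mvfderiv 𝓘(ℝ, E) (-f) x) (X x) = _
  rw [mvfderiv_neg]
  rfl

theorem along_const (X : Π x : M, Tan E M x) (c : ℝ) (x : M) :
    along X (fun _ => c) x = 0 := by
  simp [along, mvfderiv_const]

theorem bracket_swap (X Y : Π x : M, Tan E M x) (x : M) : bracket X Y x = -bracket Y X x :=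
  VectorField.mlieBracket_swap_apply

section

variable [CompleteSpace E]

theorem bracket_add_left (X Y Z : VField E M) (x : M) :
    bracket (X + Y : VField E M) Z x = bracket X Z x + bracket Y Z x :=
  VectorField.mlieBracket_add_left (X.mdiff x) (Y.mdiff x)

theorem bracket_add_right (X Y Z : VField E M) (x : M) :
    bracket X (Y + Z : VField E M) x = bracket X Y x + bracket X Z x :=
  VectorField.mlieBracket_add_right (Y.mdiff x) (Z.mdiff x)

theorem bracket_fsmul_left {f : M → ℝ} (hf : SmoothFun E f) (X Y : VField E M) (x : M) :
    bracket (fsmul f hf X) Y x = f x • bracket X Y x - along Y f x • X x := by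
  have := VectorField.mlieBracket_smul_left (W := Y) (hf.mdiff x) (X.mdiff x)
  refine this.trans ?_
  rw [neg_smul, neg_add_eq_sub]
  rfl

theorem bracket_fsmul_right {f : M → ℝ} (hf : SmoothFun E f) (X Y : VField E M) (x : M) :
    bracket X (fsmul f hf Y) x = f x • bracket X Y x + along X f x • Y x := by
  have := VectorField.mlieBracket_smul_right (V := X) (hf.mdiff x) (Y.mdiff x)
  refine this.trans ?_
  rw [add_comm]
  rfl

theorem bracket_neg_left (X Y : VField E M) (x : M) :
    bracket (-X : VField E M) Y x = -bracket X Y x := by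
  have := VectorField.mlieBracket_const_smul_left (W := Y) (c := (-1 : ℝ)) (X.mdiff x)
  rw [neg_one_smul, neg_one_smul] at this
  exact this

theorem bracket_neg_right (X Y : VField E M) (x : M) :
    bracket X (-Y : VField E M) x = -bracket X Y x := by
  rw [bracket_swap, bracket_neg_left, bracket_swap X Y]

theorem bracket_sub_left (X Y Z : VField E M) (x : M) :
    bracket (X - Y : VField E M) Z x = bracket X Z x - bracket Y Z x := by
  rw [sub_eq_add_neg, bracket_add_left, bracket_neg_left, sub_eq_add_neg]

theorem bracket_sub_right (X Y Z : VField E M) (x : M) :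
    bracket X (Y - Z : VField E M) x = bracket X Y x - bracket X Z x := by
  rw [sub_eq_add_neg, bracket_add_right, bracket_neg_right, sub_eq_add_neg]

end

/-- The Lie derivatives are defined by tensoriality, so their value on `W x` may be computed with
the field `W` itself. -/
theorem courant_snd_apply [FiniteDimensional ℝ E] (A B : BigSection E M) (W : VField E M) (x : M) :
    ((courant A B x).2 (W x) : ℝ) =
      along (vecField A) (fun y => (formField B y (W y) : ℝ)) x
        - formField B x (bracket (vecField A) W x)
        - (along (vecField B) (fun y => (formField A y (W y) : ℝ)) x
          - formField A x (bracket (vecField B) W x))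
        - 1 / 2 * (along W (fun y => (formField B y (vecField A y) : ℝ)) x
          - along W (fun y => (formField A y (vecField B y) : ℝ)) x) := by
  have h1 : (lieForm A B x (W x) : ℝ) = lieFormAux (vecPart A) (formPart B) x W :=
    TensorialAt.mkHom_apply (tensorialAt_lieFormAux _ _ x (formPart_smooth B)) (W.mdiff x)
  have h2 : (lieForm B A x (W x) : ℝ) = lieFormAux (vecPart B) (formPart A) x W :=
    TensorialAt.mkHom_apply (tensorialAt_lieFormAux _ _ x (formPart_smooth A)) (W.mdiff x)
  rw [← along_sub W (smoothFun_apply (formField B) (vecField A))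
    (smoothFun_apply (formField A) (vecField B))]
  change (lieForm A B x (W x) : ℝ) - lieForm B A x (W x) - _ = _
  rw [h1, h2]
  rfl

end VectorFields

/-! ### Involutivity criterion for Dirac-type subbundles -/

section Dirac

variable {E : Type*} [NormedAddCommGroup E] [NormedSpace ℝ E]
  {M : Type*} [TopologicalSpace M] [ChartedSpace E M] [IsManifold 𝓘(ℝ, E) ∞ M]

/-- This differentiates the real part of `ζ(W) = √-1 θ(Z, W)`; `along_comb'` does the same for the
imaginary part. -/
theorem along_comb (W : Π x : M, Tan E M x) {f₁ f₂ f₃ f₄ : M → ℝ} (h₁ : SmoothFun E f₁)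
    (h₂ : SmoothFun E f₂) (h₃ : SmoothFun E f₃) (h₄ : SmoothFun E f₄)
    (h : ∀ y, f₁ y - f₂ y = -(f₃ y + f₄ y)) (x : M) :
    along W f₁ x - along W f₂ x = -(along W f₃ x + along W f₄ x) := by
  rw [← along_sub W h₁ h₂, ← along_add W h₃ h₄, ← along_neg, funext h]

theorem along_comb' (W : Π x : M, Tan E M x) {f₁ f₂ f₃ f₄ : M → ℝ} (h₁ : SmoothFun E f₁)
    (h₂ : SmoothFun E f₂) (h₃ : SmoothFun E f₃) (h₄ : SmoothFun E f₄)
    (h : ∀ y, f₁ y + f₂ y = f₃ y - f₄ y) (x : M) :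
    along W f₁ x + along W f₂ x = along W f₃ x - along W f₄ x := by
  rw [← along_add W h₁ h₂, ← along_sub W h₃ h₄, funext h]

/-- Let `D` be an involutive family of complex tangent vectors `u + √-1 v`, any member of which
extends to a global section of `D`, and `θ` a closed 2-form. Then the complex sections `Z + ζ` with
`Z` in `D` and `ζ = √-1 θ(Z, ·)` on `D` are closed under the Courant bracket. -/
theorem isInvolutive_of_closed [FiniteDimensional ℝ E]
    {D : Π x : M, Tan E M x → Tan E M x → Prop}
    {θ : Π x : M, Tan E M x →ₗ[ℝ] Tan E M x →ₗ[ℝ] ℝ}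
    (hskew : ∀ x v w, θ x v w = -θ x w v)
    (hsmooth : ∀ X Y : VField E M, SmoothFun E (fun y => θ y (X y) (Y y)))
    (hclosed : ∀ (X Y Z : VField E M) (x : M), extDerivTwo (fun x v w => θ x v w) X Y Z x = 0)
    (hext : ∀ x u v, D x u v → ∃ U V : VField E M, U x = u ∧ V x = v ∧ ∀ y, D y (U y) (V y))
    (hD : ∀ X Y X' Y' : VField E M, (∀ x, D x (X x) (Y x)) → (∀ x, D x (X' x) (Y' x)) →
      ∀ x, D x (bracket X X' x - bracket Y Y' x) (bracket X Y' x + bracket Y X' x))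
    {L : Π x : M, Submodule ℂ (BigC E M x)}
    (hL : ∀ (x : M) (a b : Big E M x), cplx a b ∈ L x ↔ D x a.1 b.1 ∧ ∀ u v, D x u v →
      (a.2 u - b.2 v : ℝ) = -(θ x a.1 v + θ x b.1 u) ∧
      (a.2 v + b.2 u : ℝ) = θ x a.1 u - θ x b.1 v) :
    IsInvolutive L := by
  intro A B A' B' hAB hAB' x
  have hZ : ∀ y, D y (vecField A y) (vecField B y) := fun y => ((hL y _ _).1 (hAB y)).1
  have hZ' : ∀ y, D y (vecField A' y) (vecField B' y) := fun y => ((hL y _ _).1 (hAB' y)).1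
  have hζ : ∀ y u v, D y u v → _ := fun y => ((hL y _ _).1 (hAB y)).2
  have hζ' : ∀ y u v, D y u v → _ := fun y => ((hL y _ _).1 (hAB' y)).2
  rw [hL]
  refine ⟨hD _ _ _ _ hZ hZ' x, fun u v huv => ?_⟩
  -- The test vector must be extended within `D`, so that the relations on `D` can be differentiated
  -- and brackets with it stay in `D`.
  obtain ⟨U, V, rfl, rfl, hW⟩ := hext x u v huv
  have e1 := courant_snd_apply A A' U x
  have e2 := courant_snd_apply B B' U x
  have e3 := courant_snd_apply A B' V x
  have e4 := courant_snd_apply B A' V x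
  have e5 := courant_snd_apply A A' V x
  have e6 := courant_snd_apply B B' V x
  have e7 := courant_snd_apply A B' U x
  have e8 := courant_snd_apply B A' U x
  have r1 : ∀ (T : VField E M) (P Q : VField E M), (∀ y, D y (P y) (Q y)) → _ :=
    fun T P Q h => along_comb T (smoothFun_apply (formField A) P) (smoothFun_apply (formField B) Q)
      (hsmooth (vecField A) Q) (hsmooth (vecField B) P) (fun y => (hζ y _ _ (h y)).1) x
  have r2 : ∀ (T : VField E M) (P Q : VField E M), (∀ y, D y (P y) (Q y)) → _ :=
    fun T P Q h => along_comb' T (smoothFun_apply (formField A) Q) (smoothFun_apply (formField B) P)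
      (hsmooth (vecField A) P) (hsmooth (vecField B) Q) (fun y => (hζ y _ _ (h y)).2) x
  have r1' : ∀ (T : VField E M) (P Q : VField E M), (∀ y, D y (P y) (Q y)) → _ :=
    fun T P Q h => along_comb T (smoothFun_apply (formField A') P)
      (smoothFun_apply (formField B') Q)
      (hsmooth (vecField A') Q) (hsmooth (vecField B') P) (fun y => (hζ' y _ _ (h y)).1) x
  have r2' : ∀ (T : VField E M) (P Q : VField E M), (∀ y, D y (P y) (Q y)) → _ :=
    fun T P Q h => along_comb' T (smoothFun_apply (formField A') Q)
      (smoothFun_apply (formField B') P)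
      (hsmooth (vecField A') P) (hsmooth (vecField B') Q) (fun y => (hζ' y _ _ (h y)).2) x
  have sk : ∀ T P Q : VField E M, along T (fun y => θ y (P y) (Q y)) x
      = -along T (fun y => θ y (Q y) (P y)) x := fun T P Q => by
    rw [← along_neg]
    congr 1
    funext y
    exact hskew y _ _
  -- These evaluate `ζ([Z', W])` and `ζ'([Z, W])`, the brackets being again in `D`.
  have b := hζ x _ _ (hD _ _ _ _ hZ' hW x)
  have b' := hζ' x _ _ (hD _ _ _ _ hZ hW x)
  obtain ⟨X, hX⟩ : ∃ X, X = vecField A := ⟨_, rfl⟩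
  obtain ⟨Y, hY⟩ : ∃ Y, Y = vecField B := ⟨_, rfl⟩
  obtain ⟨X', hX'⟩ : ∃ X', X' = vecField A' := ⟨_, rfl⟩
  obtain ⟨Y', hY'⟩ : ∃ Y', Y' = vecField B' := ⟨_, rfl⟩
  change _ = -(θ x (bracket (vecField A) (vecField A') x - bracket (vecField B) (vecField B') x) _
    + θ x (bracket (vecField A) (vecField B') x + bracket (vecField B) (vecField A') x) _) ∧
    _ = θ x (bracket (vecField A) (vecField A') x - bracket (vecField B) (vecField B') x) _
    - θ x (bracket (vecField A) (vecField B') x + bracket (vecField B) (vecField A') x) _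
  change (((courant A A' x).2 (U x) : ℝ) - (courant B B' x).2 (U x) -
    (((courant A B' x).2 (V x) : ℝ) + (courant B A' x).2 (V x))) = _ ∧
    (((courant A A' x).2 (V x) : ℝ) - (courant B B' x).2 (V x) +
    (((courant A B' x).2 (U x) : ℝ) + (courant B A' x).2 (U x))) = _
  change ((formField A x _ : ℝ) - formField B x _ = -(θ x (vecField A x) _ + θ x (vecField B x) _))
    ∧ ((formField A x _ : ℝ) + formField B x _ = θ x (vecField A x) _ - θ x (vecField B x) _) at b
  change ((formField A' x _ : ℝ) - formField B' x _
      = -(θ x (vecField A' x) _ + θ x (vecField B' x) _))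
    ∧ ((formField A' x _ : ℝ) + formField B' x _
      = θ x (vecField A' x) _ - θ x (vecField B' x) _) at b'
  rw [e1, e2, e3, e4, e5, e6, e7, e8]
  simp only [← hX, ← hY, ← hX', ← hY', map_sub, map_add, LinearMap.sub_apply,
    LinearMap.add_apply] at *
  have c : ∀ P Q R : VField E M, _ := fun P Q R => hclosed P Q R x
  simp only [extDerivTwo] at c
  have s : ∀ P Q R : VField E M, θ x (bracket P Q x) (R x) = -θ x (R x) (bracket P Q x) :=
    fun P Q R => hskew x _ _
  simp only [s] at c ⊢
  obtain ⟨b1, b2⟩ := b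
  obtain ⟨b1', b2'⟩ := b'
  -- With `Z = X + √-1 Y`, `Z' = X' + √-1 Y'`, `W = U + √-1 V`, the two goals are the real and
  -- imaginary parts of the identity for the bracket on `W`. The first uses the four terms `c`
  -- making up the imaginary part of `dθ(Z, Z', W)`, the second those of its real part; the factor
  -- `√-1` swaps them.
  constructor
  · linarith [r1' X U V hW, r2' Y U V hW, r1 X' U V hW, r2 Y' U V hW, r1' U X Y hZ,
      r1 U X' Y' hZ', r2' V X Y hZ, r2 V X' Y' hZ', c X X' V, c X Y' U, c Y X' U, c Y Y' V,
      sk U X X', sk U Y Y', sk U X Y', sk U Y X', sk V X X', sk V Y Y', sk V X Y', sk V Y X']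
  · linarith [r2' X U V hW, r1' Y U V hW, r2 X' U V hW, r1 Y' U V hW, r1' V X Y hZ,
      r1 V X' Y' hZ', r2' U X Y hZ, r2 U X' Y' hZ', c X X' U, c Y Y' U, c X Y' V, c Y X' V,
      sk U X X', sk U Y Y', sk U X Y', sk U Y X', sk V X X', sk V Y Y', sk V X Y', sk V Y X']

end Dirac

/-! ### Real description of the complexified fibres -/

section Complexification

set_option linter.unusedSectionVars false

variable {E : Type*} [NormedAddCommGroup E] [NormedSpace ℝ E]
  {M : Type*} [TopologicalSpace M] [ChartedSpace E M] [IsManifold 𝓘(ℝ, E) ∞ M] {x : M}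

theorem cplx_inj {a b c d : Big E M x} : cplx a b = cplx c d ↔ a = c ∧ b = d := by
  constructor
  · intro h
    -- The real and imaginary part maps of `ℂ`, tensored with the identity, recover the two
    -- components.
    have h1 := congrArg (TensorProduct.lid ℝ (Big E M x))
      (congrArg (LinearMap.rTensor (Big E M x) Complex.reLm) h)
    have h2 := congrArg (TensorProduct.lid ℝ (Big E M x))
      (congrArg (LinearMap.rTensor (Big E M x) Complex.imLm) h)
    simp only [cplx, map_add, LinearMap.rTensor_tmul, TensorProduct.lid_tmul] at h1 h2
    exact ⟨by simpa using h1, by simpa using h2⟩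
  · rintro ⟨rfl, rfl⟩
    rfl

theorem cplx_add (a b c d : Big E M x) : cplx a b + cplx c d = cplx (a + c) (b + d) := by
  simp only [cplx, TensorProduct.tmul_add]
  abel

theorem smul_tmul_eq_cplx (z : ℂ) (a : Big E M x) :
    z ⊗ₜ[ℝ] a = cplx (z.re • a) (z.im • a) := by
  conv_lhs => rw [← Complex.re_add_im z]
  rw [cplx, TensorProduct.add_tmul, ← TensorProduct.smul_tmul, ← TensorProduct.smul_tmul]
  simp [Algebra.smul_def]

theorem exists_eq_cplx (z : BigC E M x) : ∃ a b : Big E M x, z = cplx a b := by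
  induction z using TensorProduct.induction_on with
  | zero => exact ⟨0, 0, by simp [cplx]⟩
  | tmul z a => exact ⟨_, _, smul_tmul_eq_cplx z a⟩
  | add z w hz hw =>
    obtain ⟨a, b, rfl⟩ := hz
    obtain ⟨c, d, rfl⟩ := hw
    exact ⟨_, _, cplx_add a b c d⟩

theorem cplx_mem_eigenI_iff {Φ : Π x : M, Big E M x →L[ℝ] Big E M x} {a b : Big E M x} :
    cplx a b ∈ eigenI Φ x ↔ Φ x a = -b ∧ Φ x b = a := by
  have h1 : (LinearMap.baseChange ℂ (Φ x : Big E M x →ₗ[ℝ] Big E M x)) (cplx a b)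
      = cplx (Φ x a) (Φ x b) := by
    simp [cplx]
  have h2 : Complex.I • cplx a b = cplx (-b) a := by
    simp only [cplx, smul_add, TensorProduct.smul_tmul', smul_eq_mul, mul_one, Complex.I_mul_I,
      TensorProduct.tmul_neg, TensorProduct.neg_tmul]
    abel
  rw [eigenI, Module.End.mem_eigenspace_iff, h1, h2, cplx_inj]

theorem pairing_add_right (a b c : Big E M x) : pairing a (b + c) = pairing a b + pairing a c := by
  simp [pairing]
  ring

theorem pairing_smul_right (r : ℝ) (a b : Big E M x) : pairing a (r • b) = r * pairing a b := by
  simp [pairing]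
  ring

/-- Real description of the fibres of `L_e ⊕ E^{(1,0)}`. -/
theorem cplx_mem_lineSum_iff {Φ : Π x : M, Big E M x →L[ℝ] Big E M x} {e f : Π x : M, Big E M x}
    (he : Φ x (e x) = 0) (hf : ∀ a, pairing (f x) (Φ x a) = 0) (hfe : 2 * pairing (f x) (e x) = 1)
    {a b : Big E M x} :
    cplx a b ∈ lineSum Φ e x ↔
      Φ x a = -(b - tensor (e x) (f x) b) ∧ Φ x b = a - tensor (e x) (f x) a := by
  constructor
  · intro h
    obtain ⟨y, hy, w, hw, hyw⟩ := Submodule.mem_sup.1 h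
    obtain ⟨z, rfl⟩ := Submodule.mem_span_singleton.1 hy
    obtain ⟨p, q, rfl⟩ := exists_eq_cplx w
    rw [cplx_mem_eigenI_iff] at hw
    rw [TensorProduct.smul_tmul', smul_eq_mul, mul_one, smul_tmul_eq_cplx, cplx_add,
      cplx_inj] at hyw
    obtain ⟨rfl, rfl⟩ := hyw
    -- Eigenvectors for `√-1` lie in the complexified image of `Φ`, which is orthogonal to `f`.
    have hp : pairing (f x) p = 0 := by rw [← hw.2, hf]
    have hq : pairing (f x) q = 0 := by
      rw [← neg_neg q, ← hw.1, ← neg_one_smul ℝ, pairing_smul_right, hf, mul_zero]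
    have key : ∀ (r : ℝ) (c : Big E M x), pairing (f x) c = 0 →
        tensor (e x) (f x) (r • e x + c) = r • e x := fun r c hc => by
      rw [tensor, pairing_add_right, pairing_smul_right, hc, add_zero, mul_left_comm, hfe, mul_one]
    rw [key _ _ hp, key _ _ hq, (Φ x).map_add, (Φ x).map_add, (Φ x).map_smul, (Φ x).map_smul, he,
      hw.1, hw.2]
    constructor <;> module
  · rintro ⟨h1, h2⟩
    -- Split with the projection `e ⊗ f` onto the line; `Φ` kills `e`, so the hypotheses say that
    -- the remainder is an eigenvector.
    refine Submodule.mem_sup.2 ⟨cplx (tensor (e x) (f x) a) (tensor (e x) (f x) b), ?_,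
      cplx (a - tensor (e x) (f x) a) (b - tensor (e x) (f x) b), ?_, ?_⟩
    · refine Submodule.mem_span_singleton.2
        ⟨⟨2 * pairing (f x) a, 2 * pairing (f x) b⟩, ?_⟩
      rw [TensorProduct.smul_tmul', smul_eq_mul, mul_one, smul_tmul_eq_cplx]
      rfl
    · rw [cplx_mem_eigenI_iff]
      have ht : ∀ c, Φ x (tensor (e x) (f x) c) = 0 := fun c => by
        rw [tensor, (Φ x).map_smul, he, smul_zero]
      rw [(Φ x).map_sub, (Φ x).map_sub, ht, ht, sub_zero, sub_zero]
      exact ⟨h1, h2⟩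
    · rw [cplx_add]
      simp

end Complexification

/-! ### The smooth tensors `Φ`, `G`, `E_±` -/

section Constructions

set_option linter.unusedSectionVars false

variable {E : Type*} [NormedAddCommGroup E] [NormedSpace ℝ E]
  {M : Type*} [TopologicalSpace M] [ChartedSpace E M] [IsManifold 𝓘(ℝ, E) ∞ M]

instance [FiniteDimensional ℝ E] (x : M) : FiniteDimensional ℝ (Tan E M x) :=
  inferInstanceAs (FiniteDimensional ℝ E)

/-- `Φ = diag(φ, -φ^*)` on a fibre. -/
def bigPhiFun (φ : EndField E M) (x : M) : Big E M x →L[ℝ] Big E M x :=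
  ((φ x).comp (ContinuousLinearMap.fst ℝ _ _)).prod
    (-((ContinuousLinearMap.precomp (Bundle.Trivial M ℝ x) (φ x)).comp
      (ContinuousLinearMap.snd ℝ _ _)))

theorem contMDiffAt_comp_end (φ : EndField E M) {α : Π x : M, Cotan E M x} {x : M}
    [FiniteDimensional ℝ E]
    (hα : ContMDiffAt 𝓘(ℝ, E) (𝓘(ℝ, E).prod 𝓘(ℝ, E →L[ℝ] ℝ)) ∞
      (fun x => TotalSpace.mk' (E →L[ℝ] ℝ) (E := Cotan E M) x (α x)) x) :
    ContMDiffAt 𝓘(ℝ, E) (𝓘(ℝ, E).prod 𝓘(ℝ, E →L[ℝ] ℝ)) ∞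
      (fun x => TotalSpace.mk' (E →L[ℝ] ℝ) (E := Cotan E M) x ((α x).comp (φ x))) x :=
  contMDiffAt_hom_of_apply fun _ hs => hα.clm_bundle_apply ((φ.contMDiff x).clm_bundle_apply hs)

/-- The endomorphism `Φ = diag(φ, -φ^*)` of the big tangent bundle. -/
def bigPhi [FiniteDimensional ℝ E] (φ : EndField E M) : BigEnd E M :=
  ⟨bigPhiFun φ, fun x => contMDiffAt_hom_of_apply (V := Big E M) (W := Big E M) fun _ hs =>
    contMDiffAt_big_mk ((φ.contMDiff x).clm_bundle_apply (contMDiffAt_big_fst hs))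
      (contMDiffAt_comp_end φ (contMDiffAt_big_snd hs)).neg_section⟩

theorem bigPhi_apply [FiniteDimensional ℝ E] (φ : EndField E M) (x : M) (a : Big E M x) :
    bigPhi φ x a = (φ x a.1, -(a.2.comp (φ x))) := rfl

theorem finrank_cotan [FiniteDimensional ℝ E] (x : M) :
    Module.finrank ℝ (Tan E M x) = Module.finrank ℝ (Cotan E M x) := by
  have h : Module.finrank ℝ (E →ₗ[ℝ] ℝ) = Module.finrank ℝ (E →L[ℝ] ℝ) :=
    (LinearMap.toContinuousLinearMap (𝕜 := ℝ) (E := E) (F' := ℝ)).finrank_eq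
  exact (Subspace.dual_finrank_eq (K := ℝ) (V := E)).symm.trans h

theorem metric_injective (g : Metric E M) (x : M) :
    Function.Injective (g.inner x : Tan E M x →ₗ[ℝ] Cotan E M x) := by
  rw [← LinearMap.ker_eq_bot, LinearMap.ker_eq_bot']
  intro v hv
  by_contra hne
  have h := g.pos x v hne
  have hv' : g.inner x v = 0 := hv
  rw [hv'] at h
  exact lt_irrefl _ h

/-- The isomorphism `T_x M ≃ T_x^* M` given by a metric. -/
def flat [FiniteDimensional ℝ E] (g : Metric E M) (x : M) : Tan E M x ≃L[ℝ] Cotan E M x :=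
  have : FiniteDimensional ℝ (Cotan E M x) := inferInstanceAs (FiniteDimensional ℝ (E →L[ℝ] ℝ))
  have : T2Space (Cotan E M x) := inferInstanceAs (T2Space (E →L[ℝ] ℝ))
  { LinearMap.linearEquivOfInjective (g.inner x : Tan E M x →ₗ[ℝ] Cotan E M x)
      (metric_injective g x) (finrank_cotan x) with
    continuous_toFun := (g.inner x).continuous
    continuous_invFun := LinearMap.continuous_of_finiteDimensional
      (LinearMap.linearEquivOfInjective (g.inner x : Tan E M x →ₗ[ℝ] Cotan E M x)
        (metric_injective g x) (finrank_cotan x)).symm.toLinearMap }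

theorem flat_apply [FiniteDimensional ℝ E] (g : Metric E M) (x : M) (v : Tan E M x) :
    flat g x v = g.inner x v := rfl

/-- The endomorphism `G` of a fibre of the big tangent bundle which exchanges vectors and covectors
through a metric. -/
def bigMetricFun [FiniteDimensional ℝ E] (g : Metric E M) (x : M) : Big E M x →L[ℝ] Big E M x :=
  (((flat g x).symm : Cotan E M x →L[ℝ] Tan E M x).comp (ContinuousLinearMap.snd ℝ _ _)).prod
    ((g.inner x).comp (ContinuousLinearMap.fst ℝ _ _))

/-- The generalized metric `G` given by a metric. -/
def bigMetric [FiniteDimensional ℝ E] (g : Metric E M) : BigEnd E M :=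
  ⟨bigMetricFun g, fun x => contMDiffAt_hom_of_apply (V := Big E M) (W := Big E M) fun s hs =>
    have : CompleteSpace E := FiniteDimensional.complete ℝ E
    contMDiffAt_big_mk (X := fun x => (flat g x).symm (s x).2)
      -- `g⁻¹` of a smooth 1-form is smooth because the smooth invertible bundle map `g` sends it
      -- back to that 1-form.
      (contMDiffAt_of_hom_apply (V := Tan E M) (W := Cotan E M) (Φ := g.inner) (g.contMDiff x)
        (fun y => ⟨flat g y, rfl⟩) (by
          have h : ∀ y, g.inner y ((flat g y).symm (s y).2) = (s y).2 :=
            fun y => (flat g y).apply_symm_apply (s y).2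
          simp only [h]
          exact contMDiffAt_big_snd hs))
      ((g.contMDiff x).clm_bundle_apply (contMDiffAt_big_fst hs))⟩

theorem bigMetric_apply [FiniteDimensional ℝ E] (g : Metric E M) (x : M) (a : Big E M x) :
    bigMetric g x a = ((flat g x).symm a.2, g.inner x a.1) := rfl

/-- A vector field as a section of the big tangent bundle. -/
def bigOfVField (X : VField E M) : BigSection E M :=
  ⟨fun x => (X x, 0), fun x => contMDiffAt_big_mk (X.contMDiff x)
    ((0 : OneForm E M).contMDiff x)⟩

/-- A 1-form as a section of the big tangent bundle. -/
def bigOfOneForm (η : OneForm E M) : BigSection E M :=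
  ⟨fun x => (0, η x), fun x => contMDiffAt_big_mk ((0 : VField E M).contMDiff x)
    (η.contMDiff x)⟩

end Constructions

/-! ### Pointwise algebra of almost contact metric structures -/

section AlmostContact

set_option linter.unusedSectionVars false

variable {E : Type*} [NormedAddCommGroup E] [NormedSpace ℝ E]
  {M : Type*} [TopologicalSpace M] [ChartedSpace E M] [IsManifold 𝓘(ℝ, E) ∞ M]
  {φ : EndField E M} {ξ : VField E M} {η : OneForm E M} {g : Metric E M}

theorem tensor_xi_eta (x : M) (a : Big E M x) :
    tensor (x := x) (ξ x, 0) (0, η x) a = ((η x a.1 : ℝ) • ξ x, 0) := by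
  change (2 * (1 / 2 * ((a.2 0 : ℝ) + (η x a.1 : ℝ)))) • (ξ x, (0 : Cotan E M x)) = _
  rw [map_zero, zero_add, ← mul_assoc, mul_one_div_cancel two_ne_zero, one_mul, Prod.smul_mk,
    smul_zero]

theorem tensor_eta_xi (x : M) (a : Big E M x) :
    tensor (x := x) (0, η x) (ξ x, 0) a = (0, (a.2 (ξ x) : ℝ) • η x) := by
  change (2 * (1 / 2 * ((a.2 (ξ x) : ℝ) + 0))) • ((0 : Tan E M x), η x) = _
  rw [add_zero, ← mul_assoc, mul_one_div_cancel two_ne_zero, one_mul, Prod.smul_mk,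
    smul_zero]

namespace IsAlmostContactMetric

variable (x : M)

theorem xi_ne_zero (h : IsAlmostContactMetric φ ξ η g) : ξ x ≠ 0 := fun h0 => by
  have := h.eta_xi x
  rw [h0, (η x).map_zero] at this
  exact zero_ne_one this

/-- As `φ²ξ = 0`, the formula for `φ²` at `φξ` gives `φξ = cξ` with `c = η(φξ)`. Applying `φ` again
gives `c²ξ = 0`. -/
theorem eta_phi_xi (h : IsAlmostContactMetric φ ξ η g) : (η x (φ x (ξ x)) : ℝ) = 0 := by
  have h1 : φ x (φ x (ξ x)) = 0 := by rw [h.sq, h.eta_xi, one_smul, neg_add_cancel]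
  have h2 := h.sq x (φ x (ξ x))
  rw [h1, (φ x).map_zero] at h2
  have h3 : φ x (ξ x) = (η x (φ x (ξ x)) : ℝ) • ξ x := by
    rw [eq_comm, neg_add_eq_zero] at h2
    exact h2
  have h4 : (η x (φ x (ξ x)) * η x (φ x (ξ x)) : ℝ) • ξ x = 0 := by
    rw [mul_smul, ← h3, ← (φ x).map_smul, ← h3, h1]
  exact mul_self_eq_zero.1 ((smul_eq_zero.1 h4).resolve_right (h.xi_ne_zero x))

theorem phi_xi (h : IsAlmostContactMetric φ ξ η g) : φ x (ξ x) = 0 := by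
  have h1 : φ x (φ x (ξ x)) = 0 := by rw [h.sq, h.eta_xi, one_smul, neg_add_cancel]
  have h2 := h.sq x (φ x (ξ x))
  rw [h1, (φ x).map_zero, h.eta_phi_xi, zero_smul, add_zero, eq_comm, neg_eq_zero] at h2
  exact h2

/-- Compare `φ(φ²v) = -φv` with `φ²(φv) = -φv + η(φv)ξ`. -/
theorem eta_phi (h : IsAlmostContactMetric φ ξ η g) (v : Tan E M x) : (η x (φ x v) : ℝ) = 0 := by
  have h1 := h.sq x (φ x v)
  rw [h.sq x v, (φ x).map_add, (φ x).map_neg, (φ x).map_smul, h.phi_xi, smul_zero, add_zero,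
    left_eq_add] at h1
  exact (smul_eq_zero.1 h1).resolve_right (h.xi_ne_zero x)

theorem metric_xi (h : IsAlmostContactMetric φ ξ η g)
    (v : Tan E M x) : (g.inner x v (ξ x) : ℝ) = η x v := by
  have h1 := h.compat x v (ξ x)
  rw [h.phi_xi, (g.inner x (φ x v)).map_zero, h.eta_xi, mul_one, eq_comm, sub_eq_zero] at h1
  exact h1

theorem metric_xi_left (h : IsAlmostContactMetric φ ξ η g)
    (v : Tan E M x) : (g.inner x (ξ x) v : ℝ) = η x v := by
  rw [g.symm, h.metric_xi]

theorem metric_phi (h : IsAlmostContactMetric φ ξ η g) (v w : Tan E M x) :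
    (g.inner x v (φ x w) : ℝ) = -g.inner x (φ x v) w := by
  have h1 := h.compat x v (φ x w)
  rw [h.sq, h.eta_phi, mul_zero, sub_zero, (g.inner x (φ x v)).map_add,
    (g.inner x (φ x v)).map_neg, (g.inner x (φ x v)).map_smul, h.metric_xi, h.eta_phi] at h1
  rw [← h1]
  simp

theorem metric_phi_phi (h : IsAlmostContactMetric φ ξ η g) (v w : Tan E M x) :
    (g.inner x (φ x v) (φ x w) : ℝ) = g.inner x v w - η x v * η x w := h.compat x v w

theorem phi_sub_smul_xi (h : IsAlmostContactMetric φ ξ η g)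
    (r : ℝ) (v : Tan E M x) : φ x (v - r • ξ x) = φ x v := by
  rw [(φ x).map_sub, (φ x).map_smul, h.phi_xi, smul_zero, sub_zero]

theorem inner_xi_eq (h : IsAlmostContactMetric φ ξ η g) : g.inner x (ξ x) = η x := by
  ext v
  exact h.metric_xi_left x v

theorem flat_symm_eta (h : IsAlmostContactMetric φ ξ η g)
    [FiniteDimensional ℝ E] : (flat g x).symm (η x) = ξ x := by
  rw [ContinuousLinearEquiv.symm_apply_eq, flat_apply, h.inner_xi_eq]

theorem inner_phi (h : IsAlmostContactMetric φ ξ η g)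
    (v : Tan E M x) : g.inner x (φ x v) = -((g.inner x v).comp (φ x)) := by
  ext w
  change (g.inner x (φ x v) w : ℝ) = -(g.inner x v (φ x w) : ℝ)
  rw [h.metric_phi, neg_neg]

theorem flat_symm_comp (h : IsAlmostContactMetric φ ξ η g)
    [FiniteDimensional ℝ E] (α : Cotan E M x) :
    (flat g x).symm (α.comp (φ x)) = -φ x ((flat g x).symm α) := by
  obtain ⟨v, rfl⟩ := (flat g x).surjective α
  rw [ContinuousLinearEquiv.symm_apply_apply, ContinuousLinearEquiv.symm_apply_eq, map_neg,
    flat_apply, flat_apply, h.inner_phi, neg_neg]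

theorem isGenAlmostContact (h : IsAlmostContactMetric φ ξ η g) [FiniteDimensional ℝ E] :
    IsGenAlmostContact (bigPhi φ) (bigOfVField ξ) (bigOfOneForm η) where
  skew x a b := by
    change 1 / 2 * ((b.2 (φ x a.1) : ℝ) + -(a.2 (φ x b.1) : ℝ))
      + 1 / 2 * (-(b.2 (φ x a.1) : ℝ) + (a.2 (φ x b.1) : ℝ)) = 0
    ring
  sq x a := by
    change bigPhi φ x (bigPhi φ x a) = -a + tensor (x := x) (ξ x, 0) (0, η x) a
      + tensor (x := x) (0, η x) (ξ x, 0) a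
    rw [tensor_xi_eta, tensor_eta_xi, bigPhi_apply, bigPhi_apply]
    refine Prod.ext ?_ ?_
    · change φ x (φ x a.1) = -a.1 + (η x a.1 : ℝ) • ξ x + 0
      rw [h.sq, add_zero]
    · ext v
      change -(-(a.2 (φ x (φ x v)) : ℝ)) = -(a.2 v : ℝ) + 0 + (a.2 (ξ x) : ℝ) * (η x v : ℝ)
      rw [h.sq, map_add, map_neg, map_smul, smul_eq_mul]
      ring
  null_plus x := by
    change 1 / 2 * ((0 : ℝ) + 0) = 0
    norm_num
  null_minus x := by
    change 1 / 2 * ((η x 0 : ℝ) + η x 0) = 0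
    rw [map_zero]
    norm_num
  dual x := by
    change 2 * (1 / 2 * ((η x (ξ x) : ℝ) + 0)) = 1
    rw [h.eta_xi]
    norm_num

end IsAlmostContactMetric

/-- The endomorphism `G Φ`. -/
abbrev metricPhi [FiniteDimensional ℝ E] (φ : EndField E M) (g : Metric E M) (x : M) :
    Big E M x →L[ℝ] Big E M x := (bigMetric g x).comp (bigPhi φ x)

theorem metricPhi_apply [FiniteDimensional ℝ E] (x : M) (a : Big E M x) :
    metricPhi φ g x a = ((flat g x).symm (-(a.2.comp (φ x))), g.inner x (φ x a.1)) := rfl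

theorem inner_flat_symm [FiniteDimensional ℝ E] (g : Metric E M) (x : M) (α : Cotan E M x) :
    g.inner x ((flat g x).symm α) = α := (flat g x).apply_symm_apply α

theorem isGenMetric_bigMetric [FiniteDimensional ℝ E] (g : Metric E M) :
    IsGenMetric (bigMetric g) where
  selfAdjoint x a b := by
    have key : ∀ α β : Cotan E M x,
        (β ((flat g x).symm α) : ℝ) = α ((flat g x).symm β) := fun α β => by
      conv_lhs => rw [← inner_flat_symm g x β]
      conv_rhs => rw [← inner_flat_symm g x α]
      exact g.symm x _ _
    change 1 / 2 * ((b.2 ((flat g x).symm a.2) : ℝ) + g.inner x a.1 b.1)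
      = 1 / 2 * ((g.inner x b.1 a.1 : ℝ) + a.2 ((flat g x).symm b.2))
    rw [key, g.symm x a.1]
    ring
  sq x a := Prod.ext ((flat g x).symm_apply_apply a.1) ((flat g x).apply_symm_apply a.2)
  pos x a ha := by
    change 0 < 1 / 2 * ((a.2 ((flat g x).symm a.2) : ℝ) + g.inner x a.1 a.1)
    have e : (a.2 ((flat g x).symm a.2) : ℝ)
        = g.inner x ((flat g x).symm a.2) ((flat g x).symm a.2) := by
      rw [inner_flat_symm]
    have nn : ∀ v : Tan E M x, 0 ≤ (g.inner x v v : ℝ) := fun v => by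
      by_cases hv : v = 0
      · rw [hv, map_zero]
      · exact (g.pos x v hv).le
    rw [e]
    by_cases h1 : a.1 = 0
    · have h2 : (flat g x).symm a.2 ≠ 0 := fun h0 =>
        ha (Prod.ext h1 ((ContinuousLinearEquiv.map_eq_zero_iff _).1 h0))
      have := g.pos x _ h2
      have := nn a.1
      linarith
    · have := g.pos x _ h1
      have := nn ((flat g x).symm a.2)
      linarith

namespace IsAlmostContactMetric

theorem bigMetric_xi (h : IsAlmostContactMetric φ ξ η g) [FiniteDimensional ℝ E] (x : M) :
    bigMetric g x (bigOfVField ξ x) = (0, η x) := by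
  rw [bigMetric_apply]
  exact Prod.ext (map_zero _) (h.inner_xi_eq x)

theorem bigMetric_eta (h : IsAlmostContactMetric φ ξ η g) [FiniteDimensional ℝ E] (x : M) :
    bigMetric g x (bigOfOneForm η x) = (ξ x, 0) := by
  rw [bigMetric_apply]
  exact Prod.ext (h.flat_symm_eta x) (map_zero _)

/-- This is the skewness of `φ` for `g`, read on vectors and on covectors. -/
theorem bigMetric_comm (h : IsAlmostContactMetric φ ξ η g)
    [FiniteDimensional ℝ E] (x : M) (a : Big E M x) :
    bigMetric g x (bigPhi φ x a) = bigPhi φ x (bigMetric g x a) := by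
  rw [bigMetric_apply, bigPhi_apply, bigPhi_apply, bigMetric_apply]
  refine Prod.ext ?_ (h.inner_phi x a.1)
  change (flat g x).symm (-(a.2.comp (φ x))) = _
  rw [map_neg, h.flat_symm_comp, neg_neg]

/-- By commutation `-ΦGΦ = -Φ²G`; in the formula for `Φ²`, moving `G` across the pairing turns `E_+
⊗ E_-` into `E_+ ⊗ E_+`, and likewise for `E_-`. -/
theorem compat_bigMetric (h : IsAlmostContactMetric φ ξ η g)
    [FiniteDimensional ℝ E] (x : M) (a : Big E M x) :
    -(bigPhi φ x (bigMetric g x (bigPhi φ x a))) = bigMetric g x a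
      - tensor (bigOfVField ξ x) (bigOfVField ξ x) a
      - tensor (bigOfOneForm η x) (bigOfOneForm η x) a := by
  have hs := h.isGenAlmostContact.sq x (bigMetric g x a)
  rw [h.bigMetric_comm, hs]
  have p : ∀ b, pairing b (bigMetric g x a) = pairing (bigMetric g x b) a := fun b =>
    ((isGenMetric_bigMetric g).selfAdjoint x b a).symm
  simp only [tensor, p, h.bigMetric_xi, h.bigMetric_eta]
  change -(-bigMetric g x a + (2 * pairing (bigOfVField ξ x) a) • bigOfVField ξ x
    + (2 * pairing (bigOfOneForm η x) a) • bigOfOneForm η x) = _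
  abel

/-- `G` is an isometry commuting with `Φ`, so `(GΦ)² = Φ²`, and exchanging `E_±` leaves the formula
for `Φ²` unchanged. -/
theorem isGenAlmostContact_metricPhi (h : IsAlmostContactMetric φ ξ η g) [FiniteDimensional ℝ E] :
    IsGenAlmostContact (metricPhi φ g) (fun x => bigMetric g x (bigOfVField ξ x))
      (fun x => bigMetric g x (bigOfOneForm η x)) where
  skew x a b := by
    have h1 := h.isGenAlmostContact.skew x a (bigMetric g x b)
    change pairing (bigMetric g x (bigPhi φ x a)) b + pairing a (bigMetric g x (bigPhi φ x b)) = 0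
    rw [(isGenMetric_bigMetric g).selfAdjoint, h.bigMetric_comm x b, h1]
  sq x a := by
    change bigMetric g x (bigPhi φ x (bigMetric g x (bigPhi φ x a))) = _
    rw [h.bigMetric_comm x a, h.bigMetric_comm, h.bigMetric_comm, (isGenMetric_bigMetric g).sq,
      h.isGenAlmostContact.sq, h.bigMetric_xi, h.bigMetric_eta]
    change -a + tensor (bigOfVField ξ x) (bigOfOneForm η x) a
      + tensor (bigOfOneForm η x) (bigOfVField ξ x) a
      = -a + tensor (bigOfOneForm η x) (bigOfVField ξ x) a
      + tensor (bigOfVField ξ x) (bigOfOneForm η x) a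
    abel
  null_plus x := by
    rw [(isGenMetric_bigMetric g).selfAdjoint, (isGenMetric_bigMetric g).sq]
    exact h.isGenAlmostContact.null_plus x
  null_minus x := by
    rw [(isGenMetric_bigMetric g).selfAdjoint, (isGenMetric_bigMetric g).sq]
    exact h.isGenAlmostContact.null_minus x
  dual x := by
    rw [(isGenMetric_bigMetric g).selfAdjoint, (isGenMetric_bigMetric g).sq]
    exact h.isGenAlmostContact.dual x

end IsAlmostContactMetric

end AlmostContact

/-! ### The four bundles `L^±` in the form `(D, θ)` -/

section Fibres

set_option linter.unusedSectionVars false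

variable {E : Type*} [NormedAddCommGroup E] [NormedSpace ℝ E] [FiniteDimensional ℝ E]
  {M : Type*} [TopologicalSpace M] [ChartedSpace E M] [IsManifold 𝓘(ℝ, E) ∞ M]
  {φ : EndField E M} {ξ : VField E M} {η : OneForm E M} {g : Metric E M}

/-- Complex tangent vectors `u + √-1 v` in the span of `ξ` and the `√-1`-eigenspace of `φ`. -/
def HolXi (φ : EndField E M) (ξ : VField E M) (η : OneForm E M) (x : M) (u v : Tan E M x) : Prop :=
  φ x u = -(v - (η x v : ℝ) • ξ x) ∧ φ x v = u - (η x u : ℝ) • ξ x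

/-- Complex tangent vectors `u + √-1 v` in the `√-1`-eigenspace of `φ`. -/
def Hol (φ : EndField E M) (x : M) (u v : Tan E M x) : Prop := φ x u = -v ∧ φ x v = u

/-- Complex tangent vectors `u + √-1 v` in the kernel of `η`. -/
def KerEta (η : OneForm E M) (x : M) (u v : Tan E M x) : Prop :=
  (η x u : ℝ) = 0 ∧ (η x v : ℝ) = 0

/-- The fundamental form as a bilinear form. -/
def fundamentalLin (φ : EndField E M) (g : Metric E M) (x : M) :
    Tan E M x →ₗ[ℝ] Tan E M x →ₗ[ℝ] ℝ :=
  LinearMap.mk₂ ℝ (fundamentalForm φ g x)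
    (fun u v w => by simp [fundamentalForm]) (fun r v w => by simp [fundamentalForm])
    (fun u v w => by simp [fundamentalForm]) (fun r v w => by simp [fundamentalForm])

namespace IsAlmostContactMetric

variable (x : M) {a b : Big E M x}

theorem fundamentalLin_apply (h : IsAlmostContactMetric φ ξ η g) (v w : Tan E M x) :
    fundamentalLin φ g x v w = -(g.inner x (φ x v) w : ℝ) := h.metric_phi x v w

theorem fundamentalLin_skew (h : IsAlmostContactMetric φ ξ η g) (v w : Tan E M x) :
    fundamentalLin φ g x v w = -fundamentalLin φ g x w v := by
  rw [h.fundamentalLin_apply, g.symm]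
  rfl

theorem bigPhi_xi (h : IsAlmostContactMetric φ ξ η g) : bigPhi φ x (bigOfVField ξ x) = 0 := by
  rw [bigPhi_apply]
  refine Prod.ext (h.phi_xi x) ?_
  ext v
  exact neg_zero

theorem bigPhi_eta (h : IsAlmostContactMetric φ ξ η g) : bigPhi φ x (bigOfOneForm η x) = 0 := by
  rw [bigPhi_apply]
  refine Prod.ext (map_zero _) ?_
  ext v
  change -(η x (φ x v) : ℝ) = 0
  rw [h.eta_phi, neg_zero]

theorem pairing_xi_bigPhi (h : IsAlmostContactMetric φ ξ η g)
    : pairing (bigOfVField ξ x) (bigPhi φ x a) = 0 := by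
  change 1 / 2 * (-(a.2 (φ x (ξ x)) : ℝ) + 0) = 0
  rw [h.phi_xi, map_zero]
  norm_num

theorem pairing_eta_bigPhi (h : IsAlmostContactMetric φ ξ η g)
    : pairing (bigOfOneForm η x) (bigPhi φ x a) = 0 := by
  change 1 / 2 * (-(a.2 (φ x 0) : ℝ) + η x (φ x a.1)) = 0
  rw [h.eta_phi, map_zero, map_zero]
  norm_num

theorem two_pairing_eta_xi (h : IsAlmostContactMetric φ ξ η g)
    : 2 * pairing (bigOfOneForm η x) (bigOfVField ξ x) = 1 := by
  change 2 * (1 / 2 * ((0 : ℝ) + η x (ξ x))) = 1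
  rw [h.eta_xi]
  norm_num

/-- The eigenvector equation decouples: its vector half is membership in `D = ⟨ξ⟩ ⊕ T^{1,0}`, its
covector half says that the covector annihilates `D`. -/
theorem mem_lineSum_xi_iff (h : IsAlmostContactMetric φ ξ η g) :
    cplx a b ∈ lineSum (bigPhi φ) (bigOfVField ξ) x ↔ HolXi φ ξ η x a.1 b.1 ∧
      ∀ u v, HolXi φ ξ η x u v → (a.2 u - b.2 v : ℝ) = 0 ∧ (a.2 v + b.2 u : ℝ) = 0 := by
  rw [cplx_mem_lineSum_iff (f := bigOfOneForm η) (h.bigPhi_xi x)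
    (fun _ => h.pairing_eta_bigPhi x) (h.two_pairing_eta_xi x)]
  change bigPhi φ x a = -(b - tensor (x := x) (ξ x, 0) (0, η x) b)
    ∧ bigPhi φ x b = a - tensor (x := x) (ξ x, 0) (0, η x) a ↔ _
  rw [tensor_xi_eta, tensor_xi_eta, bigPhi_apply, bigPhi_apply, Prod.ext_iff, Prod.ext_iff]
  change (φ x a.1 = -(b.1 - (η x b.1 : ℝ) • ξ x) ∧ -(a.2.comp (φ x)) = -(b.2 - 0)) ∧
    (φ x b.1 = a.1 - (η x a.1 : ℝ) • ξ x ∧ -(b.2.comp (φ x)) = a.2 - 0) ↔ _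
  rw [sub_zero, sub_zero, neg_inj]
  constructor
  · rintro ⟨⟨h1, h2⟩, h3, h4⟩
    refine ⟨⟨h1, h3⟩, fun u v ⟨hu, hv⟩ => ?_⟩
    have ha : ∀ w, (a.2 (φ x w) : ℝ) = b.2 w := fun w => DFunLike.congr_fun h2 w
    have hb : ∀ w, -(b.2 (φ x w) : ℝ) = a.2 w := fun w => DFunLike.congr_fun h4 w
    have ha0 : (a.2 (ξ x) : ℝ) = 0 := by rw [← hb, h.phi_xi, map_zero, neg_zero]
    rw [← ha v, ← ha u, hu, hv, map_sub, map_neg, map_sub, map_smul, map_smul, ha0]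
    simp
  · rintro ⟨⟨h1, h3⟩, h2⟩
    -- Every real `w` is the real part of `w - √-1 φw ∈ D`, so testing on these vectors suffices.
    have key : ∀ w, HolXi φ ξ η x w (-φ x w) := fun w => by
      constructor
      · rw [map_neg, h.eta_phi]
        simp
      · rw [map_neg, h.sq]
        abel
    refine ⟨⟨h1, ?_⟩, h3, ?_⟩
    · ext w
      change (a.2 (φ x w) : ℝ) = b.2 w
      have := (h2 _ _ (key w)).2
      rw [map_neg] at this
      linarith
    · ext w
      change -(b.2 (φ x w) : ℝ) = a.2 w
      have := (h2 _ _ (key w)).1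
      rw [map_neg] at this
      linarith

/-- Here `D = T^{1,0}`. Its annihilator contains `η`, which accounts for the line spanned by `E_-`.
-/
theorem mem_lineSum_eta_iff (h : IsAlmostContactMetric φ ξ η g) :
    cplx a b ∈ lineSum (bigPhi φ) (bigOfOneForm η) x ↔ Hol φ x a.1 b.1 ∧
      ∀ u v, Hol φ x u v → (a.2 u - b.2 v : ℝ) = 0 ∧ (a.2 v + b.2 u : ℝ) = 0 := by
  rw [cplx_mem_lineSum_iff (f := bigOfVField ξ) (h.bigPhi_eta x)
    (fun _ => h.pairing_xi_bigPhi x) (h.isGenAlmostContact.dual x)]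
  change bigPhi φ x a = -(b - tensor (x := x) (0, η x) (ξ x, 0) b)
    ∧ bigPhi φ x b = a - tensor (x := x) (0, η x) (ξ x, 0) a ↔ _
  rw [tensor_eta_xi, tensor_eta_xi, bigPhi_apply, bigPhi_apply, Prod.ext_iff, Prod.ext_iff]
  change (φ x a.1 = -(b.1 - 0) ∧ -(a.2.comp (φ x)) = -(b.2 - (b.2 (ξ x) : ℝ) • η x)) ∧
    (φ x b.1 = a.1 - 0 ∧ -(b.2.comp (φ x)) = a.2 - (a.2 (ξ x) : ℝ) • η x) ↔ _
  rw [sub_zero, sub_zero, neg_inj]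
  constructor
  · rintro ⟨⟨h1, h2⟩, h3, h4⟩
    refine ⟨⟨h1, h3⟩, fun u v ⟨hu, hv⟩ => ?_⟩
    have ha : ∀ w, (a.2 (φ x w) : ℝ) = b.2 w - b.2 (ξ x) * η x w :=
      fun w => DFunLike.congr_fun h2 w
    have e1 : (η x u : ℝ) = 0 := by rw [← hv, h.eta_phi]
    have e2 : (η x v : ℝ) = 0 := by rw [← neg_neg v, ← hu, map_neg, h.eta_phi, neg_zero]
    have a1 := ha u
    have a2 := ha v
    rw [hu, map_neg, e1] at a1
    rw [hv, e2] at a2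
    constructor <;> linarith
  · rintro ⟨⟨h1, h3⟩, h2⟩
    -- The `ξ`-component must be removed first, as `η` vanishes on `T^{1,0}`.
    have key : ∀ w, Hol φ x (w - (η x w : ℝ) • ξ x) (-φ x w) := fun w => by
      constructor
      · rw [h.phi_sub_smul_xi, neg_neg]
      · rw [map_neg, h.sq]
        abel
    refine ⟨⟨h1, ?_⟩, h3, ?_⟩
    · ext w
      change (a.2 (φ x w) : ℝ) = b.2 w - b.2 (ξ x) * η x w
      have := (h2 _ _ (key w)).2
      rw [map_neg, map_sub, map_smul, smul_eq_mul] at this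
      linarith
    · ext w
      change -(b.2 (φ x w) : ℝ) = a.2 w - a.2 (ξ x) * η x w
      have := (h2 _ _ (key w)).1
      rw [map_neg, map_sub, map_smul, smul_eq_mul] at this
      linarith

theorem metricPhi_bigMetric (h : IsAlmostContactMetric φ ξ η g) (c : Big E M x) :
    metricPhi φ g x (bigMetric g x c) = bigPhi φ x c := by
  change bigMetric g x (bigPhi φ x (bigMetric g x c)) = _
  rw [← h.bigMetric_comm, (isGenMetric_bigMetric g).sq]

theorem pairing_bigMetric_metricPhi (c : Big E M x) :
    pairing (bigMetric g x c) (metricPhi φ g x a) = pairing c (bigPhi φ x a) := by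
  change pairing (bigMetric g x c) (bigMetric g x (bigPhi φ x a)) = _
  rw [(isGenMetric_bigMetric g).selfAdjoint, (isGenMetric_bigMetric g).sq]

theorem flat_symm_neg_comp_eq_iff {α : Cotan E M x} {v : Tan E M x} :
    (flat g x).symm (-(α.comp (φ x))) = v ↔ ∀ w, -(α (φ x w) : ℝ) = g.inner x v w := by
  rw [ContinuousLinearEquiv.symm_apply_eq]
  exact ⟨fun e w => DFunLike.congr_fun e w, fun e => ContinuousLinearMap.ext e⟩

/-- `G E_+ = η`, so covectors matter only modulo `η`, that is, on `ker η`. The covector half of the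
equation says `ζ = √-1 Ω(Z, ·)` there; the vector half adds only `η(Z) = 0`. -/
theorem mem_lineSum_metric_xi_iff (h : IsAlmostContactMetric φ ξ η g) :
    cplx a b ∈ lineSum (metricPhi φ g) (fun x => bigMetric g x (bigOfVField ξ x)) x ↔
      KerEta η x a.1 b.1 ∧ ∀ u v, KerEta η x u v →
      (a.2 u - b.2 v : ℝ) = -(fundamentalLin φ g x a.1 v + fundamentalLin φ g x b.1 u) ∧
      (a.2 v + b.2 u : ℝ) = fundamentalLin φ g x a.1 u - fundamentalLin φ g x b.1 v := by
  rw [cplx_mem_lineSum_iff (f := fun x => bigMetric g x (bigOfOneForm η x))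
    (by rw [h.metricPhi_bigMetric, h.bigPhi_xi])
    (fun _ => by rw [pairing_bigMetric_metricPhi, h.pairing_eta_bigPhi x])
    (by rw [(isGenMetric_bigMetric g).selfAdjoint, (isGenMetric_bigMetric g).sq,
      h.two_pairing_eta_xi])]
  rw [h.bigMetric_xi, h.bigMetric_eta, tensor_eta_xi, tensor_eta_xi, metricPhi_apply,
    metricPhi_apply, Prod.ext_iff, Prod.ext_iff]
  change ((flat g x).symm (-(a.2.comp (φ x))) = -(b.1 - 0) ∧
      g.inner x (φ x a.1) = -(b.2 - (b.2 (ξ x) : ℝ) • η x)) ∧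
    ((flat g x).symm (-(b.2.comp (φ x))) = a.1 - 0 ∧
      g.inner x (φ x b.1) = a.2 - (a.2 (ξ x) : ℝ) • η x) ↔ _
  rw [flat_symm_neg_comp_eq_iff, flat_symm_neg_comp_eq_iff, sub_zero, sub_zero]
  simp only [h.fundamentalLin_apply]
  constructor
  · rintro ⟨⟨h1, h2⟩, h3, h4⟩
    have e2 : ∀ w, (g.inner x (φ x a.1) w : ℝ) = -(b.2 w - b.2 (ξ x) * η x w) :=
      fun w => DFunLike.congr_fun h2 w
    have e4 : ∀ w, (g.inner x (φ x b.1) w : ℝ) = a.2 w - a.2 (ξ x) * η x w :=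
      fun w => DFunLike.congr_fun h4 w
    -- Testing the vector half against `ξ` gives `η(Z) = 0`.
    have k1 := h1 (ξ x)
    have k3 := h3 (ξ x)
    rw [h.phi_xi, map_zero, neg_zero, h.metric_xi] at k1 k3
    rw [map_neg, eq_comm, neg_eq_zero] at k1
    refine ⟨⟨k3.symm, k1⟩, fun u v ⟨hu, hv⟩ => ?_⟩
    rw [e2, e2, e4, e4, hu, hv]
    constructor <;> ring
  · rintro ⟨⟨ha, hb⟩, h2⟩
    have key : ∀ w, (η x (w - (η x w : ℝ) • ξ x) : ℝ) = 0 := fun w => by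
      rw [map_sub, map_smul, h.eta_xi, smul_eq_mul, mul_one, sub_self]
    have z : (η x (0 : Tan E M x) : ℝ) = 0 := map_zero _
    have hxi : ∀ v, (g.inner x (φ x v) (ξ x) : ℝ) = 0 := fun v => by
      rw [h.metric_xi, h.eta_phi]
    have k : ∀ w, (g.inner x (φ x a.1) w : ℝ) = -(b.2 w - b.2 (ξ x) * η x w) ∧
        (g.inner x (φ x b.1) w : ℝ) = a.2 w - a.2 (ξ x) * η x w := fun w => by
      obtain ⟨k1, k2⟩ := h2 _ _ ⟨key w, z⟩
      simp only [map_sub, map_smul, smul_eq_mul, map_zero, hxi] at k1 k2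
      constructor <;> linarith
    refine ⟨⟨fun w => ?_, ?_⟩, fun w => ?_, ?_⟩
    -- The covector half at `φw`, with `g(φ·, φ·) = g - η ⊗ η`, yields the vector half.
    · have := (k (φ x w)).2
      rw [h.metric_phi_phi, h.eta_phi, hb] at this
      rw [map_neg, _root_.neg_apply]
      linarith
    · ext w
      exact (k w).1
    · have := (k (φ x w)).1
      rw [h.metric_phi_phi, h.eta_phi, ha] at this
      linarith
    · ext w
      exact (k w).2

/-- `G E_- = ξ` spans the kernel of `Ω`, so adding this line gives the whole graph of `√-1 Ω`. The
`True`s stand for `D = TM ⊗ ℂ`, matching `isInvolutive_of_closed`. -/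
theorem mem_lineSum_metric_eta_iff (h : IsAlmostContactMetric φ ξ η g) :
    cplx a b ∈ lineSum (metricPhi φ g) (fun x => bigMetric g x (bigOfOneForm η x)) x ↔
      True ∧ ∀ u v : Tan E M x, True →
      (a.2 u - b.2 v : ℝ) = -(fundamentalLin φ g x a.1 v + fundamentalLin φ g x b.1 u) ∧
      (a.2 v + b.2 u : ℝ) = fundamentalLin φ g x a.1 u - fundamentalLin φ g x b.1 v := by
  rw [cplx_mem_lineSum_iff (f := fun x => bigMetric g x (bigOfVField ξ x))
    (by rw [h.metricPhi_bigMetric, h.bigPhi_eta])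
    (fun _ => by rw [pairing_bigMetric_metricPhi, h.pairing_xi_bigPhi x])
    (by rw [(isGenMetric_bigMetric g).selfAdjoint, (isGenMetric_bigMetric g).sq,
      h.isGenAlmostContact.dual])]
  rw [h.bigMetric_xi, h.bigMetric_eta, tensor_xi_eta, tensor_xi_eta, metricPhi_apply,
    metricPhi_apply, Prod.ext_iff, Prod.ext_iff]
  change ((flat g x).symm (-(a.2.comp (φ x))) = -(b.1 - (η x b.1 : ℝ) • ξ x) ∧
      g.inner x (φ x a.1) = -(b.2 - 0)) ∧
    ((flat g x).symm (-(b.2.comp (φ x))) = a.1 - (η x a.1 : ℝ) • ξ x ∧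
      g.inner x (φ x b.1) = a.2 - 0) ↔ _
  rw [flat_symm_neg_comp_eq_iff, flat_symm_neg_comp_eq_iff, sub_zero, sub_zero]
  simp only [h.fundamentalLin_apply, true_and, forall_const]
  constructor
  · rintro ⟨⟨-, h2⟩, -, h4⟩ u v
    have e2 : ∀ w, (g.inner x (φ x a.1) w : ℝ) = -b.2 w := fun w => DFunLike.congr_fun h2 w
    have e4 : ∀ w, (g.inner x (φ x b.1) w : ℝ) = a.2 w := fun w => DFunLike.congr_fun h4 w
    rw [e2, e2, e4, e4]
    constructor <;> ring
  · intro h2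
    have k : ∀ w, (g.inner x (φ x a.1) w : ℝ) = -b.2 w ∧
        (g.inner x (φ x b.1) w : ℝ) = a.2 w := fun w => by
      obtain ⟨k1, k2⟩ := h2 w 0
      simp only [map_zero] at k1 k2
      constructor <;> linarith
    have e : ∀ v w : Tan E M x, (g.inner x (v - (η x v : ℝ) • ξ x) w : ℝ)
        = g.inner x v w - η x v * η x w := fun v w => by
      rw [map_sub, map_smul, _root_.sub_apply, _root_.smul_apply,
        h.metric_xi_left, smul_eq_mul]
    refine ⟨⟨fun w => ?_, ?_⟩, fun w => ?_, ?_⟩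
    · have := (k (φ x w)).2
      rw [h.metric_phi_phi] at this
      rw [map_neg, _root_.neg_apply, e]
      linarith
    · ext w
      exact (k w).1
    · have := (k (φ x w)).1
      rw [h.metric_phi_phi] at this
      rw [e]
      linarith
    · ext w
      exact (k w).2

end IsAlmostContactMetric

end Fibres

/-! ### Extension within `D`, involutivity, and strongness -/

section Integrability

set_option linter.unusedSectionVars false

variable {E : Type*} [NormedAddCommGroup E] [NormedSpace ℝ E] [FiniteDimensional ℝ E]
  {M : Type*} [TopologicalSpace M] [ChartedSpace E M] [IsManifold 𝓘(ℝ, E) ∞ M]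
  {φ : EndField E M} {ξ : VField E M} {η : OneForm E M} {g : Metric E M}

namespace IsAlmostContactMetric

variable [T2Space M] {x : M} {u v : Tan E M x}

/-- Extend arbitrarily, then apply the smooth projection `Z ↦ ½ (Z + η(Z) ξ - √-1 φZ)` onto `⟨ξ⟩ ⊕
T^{1,0}`. -/
theorem exists_holXi (h : IsAlmostContactMetric φ ξ η g) (huv : HolXi φ ξ η x u v) :
    ∃ U V : VField E M, U x = u ∧ V x = v ∧ ∀ y, HolXi φ ξ η y (U y) (V y) := by
  obtain ⟨U, rfl⟩ := exists_vfield_eq x u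
  obtain ⟨V, rfl⟩ := exists_vfield_eq x v
  refine ⟨(1 / 2 : ℝ) • (U + fsmul _ (smoothFun_apply η U) ξ + φ.app V),
    (1 / 2 : ℝ) • (V + fsmul _ (smoothFun_apply η V) ξ - φ.app U), ?_, ?_, fun y => ?_⟩
  · change (1 / 2 : ℝ) • (U x + (η x (U x) : ℝ) • ξ x + φ x (V x)) = _
    rw [huv.2]
    module
  · change (1 / 2 : ℝ) • (V x + (η x (V x) : ℝ) • ξ x - φ x (U x)) = _
    rw [huv.1]
    module
  · change HolXi φ ξ η y ((1 / 2 : ℝ) • (U y + (η y (U y) : ℝ) • ξ y + φ y (V y)))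
      ((1 / 2 : ℝ) • (V y + (η y (V y) : ℝ) • ξ y - φ y (U y)))
    constructor
    · simp only [map_smul, map_add, map_sub, h.phi_xi, h.sq, h.eta_xi, h.eta_phi, smul_eq_mul]
      module
    · simp only [map_smul, map_add, map_sub, h.phi_xi, h.sq, h.eta_xi, h.eta_phi, smul_eq_mul]
      module

theorem exists_hol (h : IsAlmostContactMetric φ ξ η g) (huv : Hol φ x u v) :
    ∃ U V : VField E M, U x = u ∧ V x = v ∧ ∀ y, Hol φ y (U y) (V y) := by
  have hu : (η x u : ℝ) = 0 := by rw [← huv.2, h.eta_phi]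
  have hv : (η x v : ℝ) = 0 := by rw [← neg_neg v, ← huv.1, map_neg, h.eta_phi, neg_zero]
  obtain ⟨U, rfl⟩ := exists_vfield_eq x u
  obtain ⟨V, rfl⟩ := exists_vfield_eq x v
  -- The projection onto `T^{1,0}` is `Z ↦ ½ (Z - η(Z) ξ - √-1 φZ)`.
  refine ⟨(1 / 2 : ℝ) • (U - fsmul _ (smoothFun_apply η U) ξ + φ.app V),
    (1 / 2 : ℝ) • (V - fsmul _ (smoothFun_apply η V) ξ - φ.app U), ?_, ?_, fun y => ?_⟩
  · change (1 / 2 : ℝ) • (U x - (η x (U x) : ℝ) • ξ x + φ x (V x)) = _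
    rw [huv.2, hu]
    module
  · change (1 / 2 : ℝ) • (V x - (η x (V x) : ℝ) • ξ x - φ x (U x)) = _
    rw [huv.1, hv]
    module
  · change Hol φ y ((1 / 2 : ℝ) • (U y - (η y (U y) : ℝ) • ξ y + φ y (V y)))
      ((1 / 2 : ℝ) • (V y - (η y (V y) : ℝ) • ξ y - φ y (U y)))
    constructor
    · simp only [map_smul, map_add, map_sub, h.phi_xi, h.sq]
      module
    · simp only [map_smul, map_sub, h.phi_xi, h.sq]
      module

theorem exists_kerEta (h : IsAlmostContactMetric φ ξ η g) (huv : KerEta η x u v) :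
    ∃ U V : VField E M, U x = u ∧ V x = v ∧ ∀ y, KerEta η y (U y) (V y) := by
  obtain ⟨U, rfl⟩ := exists_vfield_eq x u
  obtain ⟨V, rfl⟩ := exists_vfield_eq x v
  refine ⟨U - fsmul _ (smoothFun_apply η U) ξ, V - fsmul _ (smoothFun_apply η V) ξ,
    ?_, ?_, fun y => ?_⟩
  · change U x - (η x (U x) : ℝ) • ξ x = _
    rw [huv.1, zero_smul, sub_zero]
  · change V x - (η x (V x) : ℝ) • ξ x = _
    rw [huv.2, zero_smul, sub_zero]
  · change KerEta η y (U y - (η y (U y) : ℝ) • ξ y) (V y - (η y (V y) : ℝ) • ξ y)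
    constructor <;> rw [map_sub, map_smul, h.eta_xi, smul_eq_mul, mul_one, sub_self]

end IsAlmostContactMetric

namespace IsCoKahler

theorem eta_bracket (h : IsCoKahler φ ξ η g) (X Y : VField E M) (x : M) :
    (η x (bracket X Y x) : ℝ) = along X (fun y => (η y (Y y) : ℝ)) x
      - along Y (fun y => (η y (X y) : ℝ)) x := by
  have := h.closed_eta X Y x
  rw [extDerivOne, sub_eq_zero] at this
  exact this.symm

theorem eta_bracket_of_const (h : IsCoKahler φ ξ η g)
    {X Y : VField E M} {r s : ℝ} (hX : ∀ y, (η y (X y) : ℝ) = r)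
    (hY : ∀ y, (η y (Y y) : ℝ) = s) (x : M) : (η x (bracket X Y x) : ℝ) = 0 := by
  rw [h.eta_bracket, funext hX, funext hY, along_const, along_const, sub_zero]

theorem nijenhuis_eq_zero (h : IsCoKahler φ ξ η g) (X Y : VField E M) (x : M) :
    bracket (φ.app X) (φ.app Y) x + φ x (φ x (bracket X Y x))
      - φ x (bracket X (φ.app Y) x) - φ x (bracket (φ.app X) Y x) = 0 := by
  have := h.normal X Y x
  rw [h.closed_eta, mul_zero, neg_zero, zero_smul] at this
  exact this

/-- `φ` is invariant under the flow of `ξ`. -/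
theorem phi_bracket_xi (h : IsCoKahler φ ξ η g) (X : VField E M) (x : M) :
    φ x (bracket X ξ x) = bracket (φ.app X) ξ x := by
  have hc := h.almostContactMetric
  have h0 : φ.app ξ = 0 := by
    ext y
    exact hc.phi_xi y
  have hz : ∀ Y : VField E M, bracket Y (0 : VField E M) x = 0 := fun Y => by
    exact congrFun VectorField.mlieBracket_zero_right x
  have hN := h.nijenhuis_eq_zero X ξ x
  rw [h0, hz, hz, map_zero, zero_add, sub_zero, sub_eq_zero] at hN
  -- `N_φ(X, ξ) = 0` reads `φ²[X, ξ] = φ[φX, ξ]`. One more `φ` turns both sides into the claim up to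
  -- sign, because `η[φX, ξ] = 0` by `dη = 0`.
  have hN' := congrArg (φ x) hN
  rw [hc.sq x (φ x (bracket X ξ x)), hc.sq, hc.eta_phi,
    h.eta_bracket_of_const (fun y => hc.eta_phi y (X y)) hc.eta_xi, zero_smul, add_zero, add_zero,
    neg_inj] at hN'
  exact hN'

/-- With `φX = -Y` and `φX' = -Y'`, `N_φ(X, X') = 0` becomes `φ([X, Y'] + [Y, X']) = [X, X'] - [Y,
Y']`, since `η[X, X'] = 0`. Applying `φ` gives the other equation. -/
theorem hol_bracket (h : IsCoKahler φ ξ η g)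
    (X Y X' Y' : VField E M) (hZ : ∀ x, Hol φ x (X x) (Y x))
    (hZ' : ∀ x, Hol φ x (X' x) (Y' x)) (x : M) :
    Hol φ x (bracket X X' x - bracket Y Y' x) (bracket X Y' x + bracket Y X' x) := by
  have : CompleteSpace E := FiniteDimensional.complete ℝ E
  have hc := h.almostContactMetric
  have e : φ.app X = -Y := by
    ext y
    exact (hZ y).1
  have e' : φ.app X' = -Y' := by
    ext y
    exact (hZ' y).1
  have z1 : ∀ y, (η y (X y) : ℝ) = 0 := fun y => by rw [← (hZ y).2, hc.eta_phi]
  have z1' : ∀ y, (η y (X' y) : ℝ) = 0 := fun y => by rw [← (hZ' y).2, hc.eta_phi]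
  have z2 : ∀ y, (η y (Y y) : ℝ) = 0 := fun y => by
    rw [← neg_neg (Y y), ← (hZ y).1, map_neg, hc.eta_phi, neg_zero]
  have z2' : ∀ y, (η y (Y' y) : ℝ) = 0 := fun y => by
    rw [← neg_neg (Y' y), ← (hZ' y).1, map_neg, hc.eta_phi, neg_zero]
  have hN := h.nijenhuis_eq_zero X X' x
  rw [e, e', bracket_neg_left, bracket_neg_right, bracket_neg_right, bracket_neg_left, hc.sq,
    h.eta_bracket_of_const z1 z1', map_neg, map_neg] at hN
  have hQ : φ x (bracket X Y' x + bracket Y X' x) = bracket X X' x - bracket Y Y' x := by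
    rw [map_add]
    refine sub_eq_zero.1 (Eq.trans ?_ hN)
    module
  refine ⟨?_, hQ⟩
  rw [← hQ, hc.sq, map_add, h.eta_bracket_of_const z1 z2', h.eta_bracket_of_const z2 z1',
    add_zero, zero_smul, add_zero]

/-- The argument for `T^{1,0}` now holds modulo `ξ`: `φX = -Y + η(Y)ξ` creates brackets with `ξ`,
which cancel modulo `ξ` by `L_ξ φ = 0`. -/
theorem holXi_bracket (h : IsCoKahler φ ξ η g)
    (X Y X' Y' : VField E M) (hZ : ∀ x, HolXi φ ξ η x (X x) (Y x))
    (hZ' : ∀ x, HolXi φ ξ η x (X' x) (Y' x)) (x : M) :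
    HolXi φ ξ η x (bracket X X' x - bracket Y Y' x) (bracket X Y' x + bracket Y X' x) := by
  have : CompleteSpace E := FiniteDimensional.complete ℝ E
  have hc := h.almostContactMetric
  have e : φ.app X = -(Y - fsmul _ (smoothFun_apply η Y) ξ) := by
    ext y
    exact (hZ y).1
  have e' : φ.app X' = -(Y' - fsmul _ (smoothFun_apply η Y') ξ) := by
    ext y
    exact (hZ' y).1
  have hξ : bracket ξ ξ x = 0 := congrFun VectorField.mlieBracket_self x
  have l := h.phi_bracket_xi X x
  have l' := h.phi_bracket_xi X' x
  have hN := h.nijenhuis_eq_zero X X' x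
  rw [e] at l
  rw [e'] at l'
  rw [e, e', hc.sq] at hN
  simp only [bracket_neg_left, bracket_neg_right, bracket_sub_left, bracket_sub_right,
    bracket_fsmul_left, bracket_fsmul_right, hξ, bracket_swap ξ X', bracket_swap ξ Y', map_neg,
    map_sub, map_add, map_smul, hc.phi_xi, l, l'] at hN
  obtain ⟨c, hcQ⟩ : ∃ c : ℝ, φ x (bracket X Y' x + bracket Y X' x)
      = bracket X X' x - bracket Y Y' x + c • ξ x := by
    -- The `ξ`-coefficient collected from the expanded torsion. Its form is immaterial: applying `η`
    -- below determines `c`, because `η ∘ φ = 0`.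
    refine ⟨η x (Y x) * along ξ (fun y => (η y (Y' y) : ℝ)) x
      - along Y' (fun y => (η y (Y y) : ℝ)) x - η x (bracket X X' x)
      - along (-(Y - fsmul _ (smoothFun_apply η Y) ξ) : VField E M)
        (fun y => (η y (Y' y) : ℝ)) x, ?_⟩
    rw [map_add]
    refine sub_eq_zero.1 (Eq.trans ?_ hN)
    module
  have hη := congrArg (η x) hcQ
  rw [hc.eta_phi, map_add, map_smul, hc.eta_xi, smul_eq_mul, mul_one] at hη
  have hc' : c = -η x (bracket X X' x - bracket Y Y' x) := by
    rw [eq_neg_iff_add_eq_zero, add_comm]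
    exact hη.symm
  have hQ : φ x (bracket X Y' x + bracket Y X' x) = bracket X X' x - bracket Y Y' x
      - (η x (bracket X X' x - bracket Y Y' x) : ℝ) • ξ x := by
    rw [hcQ, hc', neg_smul, ← sub_eq_add_neg]
  refine ⟨?_, hQ⟩
  rw [← hc.phi_sub_smul_xi x (η x (bracket X X' x - bracket Y Y' x)), ← hQ, hc.sq]
  abel

theorem kerEta_bracket (h : IsCoKahler φ ξ η g)
    (X Y X' Y' : VField E M) (hZ : ∀ x, KerEta η x (X x) (Y x))
    (hZ' : ∀ x, KerEta η x (X' x) (Y' x)) (x : M) :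
    KerEta η x (bracket X X' x - bracket Y Y' x) (bracket X Y' x + bracket Y X' x) := by
  constructor
  · rw [map_sub, h.eta_bracket_of_const (fun y => (hZ y).1) (fun y => (hZ' y).1),
      h.eta_bracket_of_const (fun y => (hZ y).2) (fun y => (hZ' y).2), sub_zero]
  · rw [map_add, h.eta_bracket_of_const (fun y => (hZ y).1) (fun y => (hZ' y).2),
      h.eta_bracket_of_const (fun y => (hZ y).2) (fun y => (hZ' y).1), add_zero]

theorem isStrong_bigPhi (h : IsCoKahler φ ξ η g) [T2Space M] :
    IsStrong (bigPhi φ) (bigOfVField ξ) (bigOfOneForm η) := by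
  have hc := h.almostContactMetric
  have h0 : ∀ (X Y Z : VField E M) (x : M), extDerivTwo (fun x v w =>
      (0 : Tan E M x →ₗ[ℝ] Tan E M x →ₗ[ℝ] ℝ) v w) X Y Z x = 0 := fun X Y Z x => by
    simp [extDerivTwo, along_const]
  refine ⟨hc.isGenAlmostContact, ?_, ?_⟩
  · exact isInvolutive_of_closed (D := HolXi φ ξ η) (θ := fun _ => 0) (fun _ _ _ => by simp)
      (fun _ _ => contMDiff_const) h0 (fun _ _ _ => hc.exists_holXi) h.holXi_bracket
      (fun x a b => by simpa using hc.mem_lineSum_xi_iff x)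
  · exact isInvolutive_of_closed (D := Hol φ) (θ := fun _ => 0) (fun _ _ _ => by simp)
      (fun _ _ => contMDiff_const) h0 (fun _ _ _ => hc.exists_hol) h.hol_bracket
      (fun x a b => by simpa using hc.mem_lineSum_eta_iff x)

theorem isStrong_metricPhi (h : IsCoKahler φ ξ η g) [T2Space M] :
    IsStrong (metricPhi φ g) (fun x => bigMetric g x (bigOfVField ξ x))
      (fun x => bigMetric g x (bigOfOneForm η x)) := by
  have hc := h.almostContactMetric
  have hs : ∀ X Y : VField E M, SmoothFun E (fun y => fundamentalLin φ g y (X y) (Y y)) :=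
    fun X Y => smoothFun_metric g X (φ.app Y)
  refine ⟨hc.isGenAlmostContact_metricPhi, ?_, ?_⟩
  · exact isInvolutive_of_closed (D := KerEta η) (θ := fundamentalLin φ g) hc.fundamentalLin_skew
      hs h.closed_fundamental (fun _ _ _ => hc.exists_kerEta) h.kerEta_bracket
      (fun x a b => hc.mem_lineSum_metric_xi_iff x)
  · refine isInvolutive_of_closed (D := fun _ _ _ => True) (θ := fundamentalLin φ g)
      hc.fundamentalLin_skew hs h.closed_fundamental (fun x u v _ => ?_)
      (fun _ _ _ _ _ _ _ => trivial) (fun x a b => hc.mem_lineSum_metric_eta_iff x)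
    obtain ⟨U, hU⟩ := exists_vfield_eq x u
    obtain ⟨V, hV⟩ := exists_vfield_eq x v
    exact ⟨U, V, hU, hV, fun _ => trivial⟩

/-- Only `L_ξ η` and `d(η(ξ))` could contribute; since `dη = 0` and `η(ξ)` is constant, both vanish.
-/
theorem courant_xi_eta (h : IsCoKahler φ ξ η g)
    [T2Space M] (x : M) : courant (bigOfVField ξ) (bigOfOneForm η) x = 0 := by
  have hc := h.almostContactMetric
  refine Prod.ext (congrFun VectorField.mlieBracket_zero_right x) ?_
  ext w
  obtain ⟨W, rfl⟩ := exists_vfield_eq x w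
  rw [courant_snd_apply]
  have hz : bracket (0 : VField E M) W x = 0 := congrFun VectorField.mlieBracket_zero_left x
  change along ξ (fun y => (η y (W y) : ℝ)) x - η x (bracket ξ W x)
    - (along (0 : VField E M) (fun _ => (0 : ℝ)) x - 0)
    - 1 / 2 * (along W (fun y => (η y (ξ y) : ℝ)) x - along W (fun _ => (0 : ℝ)) x) = 0
  rw [h.eta_bracket, funext hc.eta_xi]
  simp only [along_const]
  ring

end IsCoKahler

end Integrability

end GenCoKahler

end

theorem proposition3p5 {E : Type*} [NormedAddCommGroup E] [NormedSpace ℝ E]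
    [FiniteDimensional ℝ E]
    {M : Type*} [TopologicalSpace M] [T2Space M] [ChartedSpace E M] [IsManifold 𝓘(ℝ, E) ∞ M]
    (φ : GenCoKahler.EndField E M) (ξ : GenCoKahler.VField E M) (η : GenCoKahler.OneForm E M)
    (g : GenCoKahler.Metric E M) (h : GenCoKahler.IsCoKahler φ ξ η g) :
    ∃ (Φ : GenCoKahler.BigEnd E M) (Ep Em : GenCoKahler.BigSection E M)
      (G : GenCoKahler.BigEnd E M),
      (∀ (x : M) (X : GenCoKahler.Tan E M x) (α : GenCoKahler.Cotan E M x),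
        Φ x (X, α) = (φ x X, -(α.comp (φ x)))) ∧
      (∀ x : M, Ep x = (ξ x, 0)) ∧
      (∀ x : M, Em x = (0, η x)) ∧
      (∀ (x : M) (X : GenCoKahler.Tan E M x) (α : GenCoKahler.Cotan E M x),
        g.inner x (G x (X, α)).1 = α ∧ (G x (X, α)).2 = g.inner x X) ∧
      GenCoKahler.IsGenCoKahler Φ Ep Em G := by
  have hc := h.almostContactMetric
  exact ⟨GenCoKahler.bigPhi φ, GenCoKahler.bigOfVField ξ, GenCoKahler.bigOfOneForm η,
    GenCoKahler.bigMetric g, fun _ _ _ => rfl, fun _ => rfl, fun _ => rfl,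
    -- The vector `g⁻¹α` is characterized by its image under `g`, which is injective.
    fun x _ α => ⟨GenCoKahler.inner_flat_symm g x α, rfl⟩,
    { strong := h.isStrong_bigPhi
      bracket_zero := h.courant_xi_eta
      genMetric := GenCoKahler.isGenMetric_bigMetric g
      compat := hc.compat_bigMetric
      strong_comp := h.isStrong_metricPhi }⟩
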